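/- For a matrix $\mathbf X\in\mathbb R^{d\times n}$ with $d\ge 1$, a number $\lambda\ge 0$ and an integer $0\le s\le n$, where either $\lambda>0$, or $\lambda=0$, $\operatorname{rank}\mathbf X=d$ and $s\ge d$, $\lambda$-regularized size-$s$ volume sampling from $\mathbf X$ is the law of the random set $S\subseteq\{1,\dots,n\}$ with $|S|=s$ obtained as follows: start with $S=\{1,\dots,n\}$ and, while $|S|>s$, remove from $S$ a random element $i\in S$, drawn with conditional probability $$P(i\mid S)\ \propto\ \frac{\det(\mathbf X_{S\setminus\{i\}}\mathbf X_{S\setminus\{i\}}^\top+\lambda\mathbf I)}{\det(\mathbf X_S\mathbf X_S^\top+\lambda\mathbf I)},$$ where $\mathbf X_S$ consists of the columns of $\mathbf X$ with index in $S$. Consider randomized real-RAM programs: one step is one arithmetic operation ($+,-,\times,/$) on real numbers, one addition or subtraction of integers, one copy, one load or store of an array entry, one comparison or control transfer, one draw of a uniform integer from $\{0,\dots,k-1\}$, or one draw of a Bernoulli$(p)$ variable, where $k$ and $p$ are contents of registers. **Theorem.** There are one such program and an absolute constant $C$ such that for all $d,n,s,\mathbf X,\lambda$ as above the following holds on input $(\mathbf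 X,n,d,s,\lambda)$: 1. the output of the program is distributed exactly according to $\lambda$-regularized size-$s$ volume sampling from $\mathbf X$; 2. for every $\delta>0$, with probability at least $1-\delta$ the program halts within $$C\left(n+d+\log^{+}\!\left(\frac nd\right)\log\left(\frac1\delta\right)\right)d^2$$ steps, where $\log^+ x=\max\{0,\log x\}$ (so $\log^+(n/d)=\log(n/d)$ when $n\ge d$) and $\log^+0=0$. -/

import Mathlib

/-! ## Regularized volume sampling -/

namespace VolumeSampling

variable {d n : ℕ}

/-- `X_S`: the columns of `X` with index in `S`. -/
def cols (X : Matrix (Fin d) (Fin n) ℝ) (S : Finset (Fin n)) : Matrix (Fin d) S ℝ :=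
  X.submatrix id Subtype.val

/-- `det (X_S X_Sᵀ + lam I)`. -/
noncomputable def regDet (X : Matrix (Fin d) (Fin n) ℝ) (lam : ℝ) (S : Finset (Fin n)) : ℝ :=
  (cols X S * (cols X S).transpose + lam • (1 : Matrix (Fin d) (Fin d) ℝ)).det

/-- The unnormalized weight `det (X_{S-i} X_{S-i}ᵀ + lam I) / det (X_S X_Sᵀ + lam I)`
of removing `i` from `S`. -/
noncomputable def removalWeight (X : Matrix (Fin d) (Fin n) ℝ) (lam : ℝ) (S : Finset (Fin n))
    (i : Fin n) : ℝ :=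
  regDet X lam (S.erase i) / regDet X lam S

/-- `P(i | S)`: the conditional probability of removing `i ∈ S` from the current set `S`. -/
noncomputable def removalProb (X : Matrix (Fin d) (Fin n) ℝ) (lam : ℝ) (S : Finset (Fin n))
    (i : Fin n) : ℝ :=
  removalWeight X lam S i / ∑ j ∈ S, removalWeight X lam S j

/-- The probability that, starting from `{1, …, n}`, the current set is `T` after `k` successive
random removals with the conditional probabilities `removalProb`. -/
noncomputable def probAfter (X : Matrix (Fin d) (Fin n) ℝ) (lam : ℝ) :
    ℕ → Finset (Fin n) → ℝ
  | 0, T => if T = Finset.univ then 1 else 0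
  | k + 1, T => ∑ i ∈ Tᶜ, probAfter X lam k (insert i T) * removalProb X lam (insert i T) i

/-- The probability of `T` under `lam`-regularized size `s` volume sampling from `X` (`s ≤ n`). -/
noncomputable def regVolProb (X : Matrix (Fin d) (Fin n) ℝ) (lam : ℝ) (s : ℕ)
    (T : Finset (Fin n)) : ℝ :=
  probAfter X lam (n - s) T

end VolumeSampling

/-! ## A randomized real RAM

Integer and real registers, integer arrays and two-dimensional real arrays. A program is a
finite piece of text; registers and arrays are named by literals occurring in it. Every
instruction performs one operation, and each instruction, test or control transfer is one step. -/

namespace RealRAM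

/-- Memory contents. -/
structure State where
  /-- integer registers -/
  nreg : ℕ → ℕ
  /-- real registers -/
  rreg : ℕ → ℝ
  /-- integer arrays: `narr A i` is the entry `A[i]` -/
  narr : ℕ → ℕ → ℕ
  /-- real arrays: `rarr A i j` is the entry `A[i][j]` -/
  rarr : ℕ → ℕ → ℕ → ℝ

/-- Elementary instructions; the first argument is the register or array written to. -/
inductive Instr where
  | nconst (a k : ℕ)
  | ncopy (a b : ℕ)
  | nadd (a b c : ℕ)
  | nsub (a b c : ℕ)
  | nload (a A i : ℕ)
  | nstore (A i a : ℕ)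
  | rconst (a : ℕ) (q : ℚ)
  | rcopy (a b : ℕ)
  | radd (a b c : ℕ)
  | rsub (a b c : ℕ)
  | rmul (a b c : ℕ)
  | rdiv (a b c : ℕ)
  | rload (a A i j : ℕ)
  | rstore (A i j a : ℕ)
  /-- integer register `a` receives a uniform element of `{0, …, b - 1}` (and `0` if `b = 0`),
  where `b` is the content of integer register `b` -/
  | unif (a b : ℕ)
  /-- integer register `a` receives a Bernoulli variable whose parameter is the content of real
  register `p`, truncated to `[0, 1]` -/
  | flip (a p : ℕ)

namespace State

def setN (σ : State) (a v : ℕ) : State :=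
  { σ with nreg := Function.update σ.nreg a v }

noncomputable def setR (σ : State) (a : ℕ) (v : ℝ) : State :=
  { σ with rreg := Function.update σ.rreg a v }

def setNArr (σ : State) (A i v : ℕ) : State :=
  { σ with narr := Function.update σ.narr A (Function.update (σ.narr A) i v) }

noncomputable def setRArr (σ : State) (A i j : ℕ) (v : ℝ) : State :=
  { σ with rarr := Function.update σ.rarr A (Function.update (σ.rarr A) i
      (Function.update (σ.rarr A i) j v)) }

end State

/-- The Bernoulli law with parameter `q`. -/
noncomputable def coin (q : NNReal) (hq : q ≤ 1) : PMF Bool :=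
  PMF.ofFintype (fun b => if b then (q : ENNReal) else 1 - q) (by
    simp only [Fintype.sum_bool, if_true, Bool.false_eq_true, if_false]
    exact add_tsub_cancel_of_le (by exact_mod_cast hq))

/-- The law of the memory contents after one instruction. -/
noncomputable def Instr.exec (σ : State) : Instr → PMF State
  | .nconst a k => PMF.pure (σ.setN a k)
  | .ncopy a b => PMF.pure (σ.setN a (σ.nreg b))
  | .nadd a b c => PMF.pure (σ.setN a (σ.nreg b + σ.nreg c))
  | .nsub a b c => PMF.pure (σ.setN a (σ.nreg b - σ.nreg c))
  | .nload a A i => PMF.pure (σ.setN a (σ.narr A (σ.nreg i)))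
  | .nstore A i a => PMF.pure (σ.setNArr A (σ.nreg i) (σ.nreg a))
  | .rconst a q => PMF.pure (σ.setR a (q : ℝ))
  | .rcopy a b => PMF.pure (σ.setR a (σ.rreg b))
  | .radd a b c => PMF.pure (σ.setR a (σ.rreg b + σ.rreg c))
  | .rsub a b c => PMF.pure (σ.setR a (σ.rreg b - σ.rreg c))
  | .rmul a b c => PMF.pure (σ.setR a (σ.rreg b * σ.rreg c))
  | .rdiv a b c => PMF.pure (σ.setR a (σ.rreg b / σ.rreg c))
  | .rload a A i j => PMF.pure (σ.setR a (σ.rarr A (σ.nreg i) (σ.nreg j)))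
  | .rstore A i j a => PMF.pure (σ.setRArr A (σ.nreg i) (σ.nreg j) (σ.rreg a))
  | .unif a b =>
      match σ.nreg b with
      | 0 => PMF.pure (σ.setN a 0)
      | k + 1 => (PMF.uniformOfFintype (Fin (k + 1))).map fun v => σ.setN a v
  | .flip a p =>
      (coin (min 1 (σ.rreg p).toNNReal) (min_le_left _ _)).map
        fun v => σ.setN a (if v then 1 else 0)

/-- Comparisons of two registers. -/
inductive Test where
  | nlt (a b : ℕ)
  | rlt (a b : ℕ)

def Test.Holds (σ : State) : Test → Prop
  | .nlt a b => σ.nreg a < σ.nreg b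
  | .rlt a b => σ.rreg a < σ.rreg b

/-- Programs: `cond t p q` is "if `t` then `p` else `q`", `loop t p` is "while `t` do `p`". -/
inductive Prog where
  | skip
  | op (o : Instr)
  | seq (p q : Prog)
  | cond (t : Test) (p q : Prog)
  | loop (t : Test) (p : Prog)

/-- The programs that remain to be executed, in this order, and the memory contents. -/
abbrev Config := List Prog × State

open Classical in
/-- The law of the configuration after one step; configurations `([], σ)` have halted. -/
noncomputable def step : Config → PMF Config
  | ([], σ) => PMF.pure ([], σ)
  | (.skip :: K, σ) => PMF.pure (K, σ)
  | (.op o :: K, σ) => (o.exec σ).map fun σ' => (K, σ')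
  | (.seq p q :: K, σ) => PMF.pure (p :: q :: K, σ)
  | (.cond t p q :: K, σ) => PMF.pure (if t.Holds σ then p :: K else q :: K, σ)
  | (.loop t p :: K, σ) => PMF.pure (if t.Holds σ then p :: .loop t p :: K else K, σ)

/-- The law of the configuration after a given number of steps. -/
noncomputable def run : ℕ → Config → PMF Config
  | 0, c => PMF.pure c
  | t + 1, c => (step c).bind (run t)

/-- The probability that program `p`, started on memory `σ`, halts within `t` steps with memory
contents satisfying `Q`. -/
noncomputable def haltProb (p : Prog) (σ : State) (t : ℕ) (Q : State → Prop) : ENNReal :=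
  (run t ([p], σ)).toOuterMeasure {c | c.1 = [] ∧ Q c.2}

/-- Input convention: `n`, `d`, `s` in integer registers `0`, `1`, `2`, the regularization
parameter in real register `0`, the matrix in real array `0`, and zeros elsewhere. -/
noncomputable def input {d n : ℕ} (X : Matrix (Fin d) (Fin n) ℝ) (lam : ℝ) (s : ℕ) : State where
  nreg a := if a = 0 then n else if a = 1 then d else if a = 2 then s else 0
  rreg a := if a = 0 then lam else 0
  narr _ _ := 0
  rarr A i j := if h : A = 0 ∧ i < d ∧ j < n then X ⟨i, h.2.1⟩ ⟨j, h.2.2⟩ else 0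

/-- Output convention: the sampled set is listed in the first `s` entries of integer array `0`. -/
def output (n s : ℕ) (σ : State) : Finset (Fin n) :=
  {j | (j : ℕ) ∈ (Finset.range s).image (σ.narr 0)}

end RealRAM

/-! Write `A_S` for the regularized Gram matrix. By the matrix determinant lemma the weight of
removing `i` is `lev S i = 1 - xᵢᵀ A_S⁻¹ xᵢ` (`removalWeight_eq_lev`), a number in `[0, 1]` that
costs `O(d²)` once `A_S⁻¹` is known. A trace identity gives `∑ lev ≥ |S| - d` (`sum_lev`), and
Sherman–Morrison updates the inverse in `O(d²)` after a removal (`inv_erase`).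

While `|S| > max s (2d)`, propose a uniform `i ∈ S` and remove it with probability `lev S i`.
Conditionally on acceptance this is the required law, and acceptance has probability at least `(|S|
- d)/|S| ≥ 1/2`. Hence `O(n + log (1/δ))` proposals suffice with probability `1 - δ`. If removals
are still needed below this threshold, then `|S| ≤ 2d`; all weights are then stored, sampled exactly
in `O(|S|)`, and refreshed by a rank-one formula in `O(|S| d) = O(d²)` (`lev_erase`). At most `2d`
such removals cost `O(d³)` and never fail. The initial inverse is obtained from the identity by `n +
d` rank-one updates.

The law is handled by lower bounds only. Backward recursion defines `condProb`, the chance that `k`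
further removals end in a given event, and `le_val_sampleProg` bounds the probability of halting in
the event below by `condProb` minus `2^n (3/4)^r`, where `r` budgets the trials. For the sure event
this is the running time. For the events `output = T` it gives, as `r` grows, lower bounds that
already sum to one, while the true probabilities sum to at most one; so all of them are equalities.

The logarithmic factor is needed only when rejection takes place. Then `n > 2d`, so `log (n/d)` is
bounded below by a constant; otherwise the running time is bounded deterministically. -/

namespace RealRAM

/-! ## Terminating deterministic computations -/

/-- From memory `σ`, program `p` deterministically terminates within `k` steps, and the resulting
memory satisfies `P`. -/
def Term (p : Prog) (σ : State) (k : ℕ) (P : State → Prop) : Prop :=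
  ∃ σ', P σ' ∧ ∃ k' ≤ k, ∀ K t, run (t + k') (p :: K, σ) = run t (K, σ')

theorem run_succ_of_step {c c' : Config} (h : step c = PMF.pure c') (t : ℕ) :
    run (t + 1) c = run t c' := by
  rw [run, h, PMF.pure_bind]

theorem Term.mono {p σ k k'} {P P' : State → Prop} (h : Term p σ k P) (hk : k ≤ k')
    (hP : ∀ σ', P σ' → P' σ') : Term p σ k' P' := by
  obtain ⟨σ', h1, j, hj, h2⟩ := h
  exact ⟨σ', hP _ h1, j, hj.trans hk, h2⟩

theorem Term.skip {σ : State} {P : State → Prop} (h : P σ) : Term .skip σ 1 P :=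
  ⟨σ, h, 1, le_rfl, fun _ t => run_succ_of_step rfl t⟩

theorem Term.op {o : Instr} {σ σ' : State} {P : State → Prop} (ho : o.exec σ = PMF.pure σ')
    (h : P σ') : Term (.op o) σ 1 P :=
  ⟨σ', h, 1, le_rfl, fun K t => run_succ_of_step (by simp [step, ho, PMF.pure_map]) t⟩

theorem Term.seq {p q : Prog} {σ : State} {k l : ℕ} {P Q : State → Prop} (hp : Term p σ k P)
    (hq : ∀ σ', P σ' → Term q σ' l Q) : Term (.seq p q) σ (k + l + 1) Q := by
  obtain ⟨σ₁, h1, k₁, hk₁, r1⟩ := hp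
  obtain ⟨σ₂, h2, k₂, hk₂, r2⟩ := hq σ₁ h1
  refine ⟨σ₂, h2, k₂ + k₁ + 1, by omega, fun K t => ?_⟩
  rw [show t + (k₂ + k₁ + 1) = (t + k₂ + k₁) + 1 by ring,
    run_succ_of_step (c' := (p :: q :: K, σ)) rfl, r1, r2]

theorem Term.cond_true {t : Test} {p q : Prog} {σ : State} {k : ℕ} {P : State → Prop}
    (ht : t.Holds σ) (hp : Term p σ k P) : Term (.cond t p q) σ (k + 1) P := by
  obtain ⟨σ₁, h1, k₁, hk₁, r1⟩ := hp
  refine ⟨σ₁, h1, k₁ + 1, by omega, fun K u => ?_⟩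
  rw [← add_assoc, run_succ_of_step (c' := (p :: K, σ)) (by simp [step, ht]), r1]

theorem Term.cond_false {t : Test} {p q : Prog} {σ : State} {k : ℕ} {P : State → Prop}
    (ht : ¬ t.Holds σ) (hq : Term q σ k P) : Term (.cond t p q) σ (k + 1) P := by
  obtain ⟨σ₁, h1, k₁, hk₁, r1⟩ := hq
  refine ⟨σ₁, h1, k₁ + 1, by omega, fun K u => ?_⟩
  rw [← add_assoc, run_succ_of_step (c' := (q :: K, σ)) (by simp [step, ht]), r1]

/-- A loop that has `m` of its `N` rounds left, with invariant `I` indexed by the number of rounds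
performed. -/
theorem Term.loop_aux {t : Test} {p : Prog} {k N : ℕ} (I : ℕ → State → Prop)
    (ht : ∀ i σ, i ≤ N → I i σ → (t.Holds σ ↔ i < N))
    (hp : ∀ i σ, i < N → I i σ → Term p σ k (I (i + 1))) (m : ℕ) :
    ∀ i σ, i + m = N → I i σ → Term (.loop t p) σ (m * (k + 1) + 1) (I N) := by
  induction m with
  | zero =>
    intro i σ hi h
    obtain rfl : i = N := by omega
    refine ⟨σ, h, 1, by omega, fun K u => run_succ_of_step ?_ u⟩
    simp [step, ht i σ le_rfl h]
  | succ m ih =>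
    intro i σ hi h
    obtain ⟨σ₁, h1, k₁, hk₁, r1⟩ := hp i σ (by omega) h
    obtain ⟨σ₂, h2, k₂, hk₂, r2⟩ := ih (i + 1) σ₁ (by omega) h1
    refine ⟨σ₂, h2, k₂ + k₁ + 1, by nlinarith, fun K u => ?_⟩
    have hs : step (.loop t p :: K, σ) = PMF.pure (p :: .loop t p :: K, σ) := by
      simp [step, (ht i σ (by omega) h).2 (by omega)]
    rw [show u + (k₂ + k₁ + 1) = (u + k₂ + k₁) + 1 by ring, run_succ_of_step hs, r1, r2]

theorem Term.loop {t : Test} {p : Prog} {k N : ℕ} {σ : State} (I : ℕ → State → Prop)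
    (ht : ∀ i σ, i ≤ N → I i σ → (t.Holds σ ↔ i < N))
    (hp : ∀ i σ, i < N → I i σ → Term p σ k (I (i + 1))) (h0 : I 0 σ) :
    Term (.loop t p) σ (N * (k + 1) + 1) (I N) :=
  Term.loop_aux I ht hp N 0 σ (by simp) h0

/-! ## Straight-line code -/

/-- The effect of an instruction that draws no random number. -/
noncomputable def Instr.det (σ : State) : Instr → State
  | .nconst a k => σ.setN a k
  | .ncopy a b => σ.setN a (σ.nreg b)
  | .nadd a b c => σ.setN a (σ.nreg b + σ.nreg c)
  | .nsub a b c => σ.setN a (σ.nreg b - σ.nreg c)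
  | .nload a A i => σ.setN a (σ.narr A (σ.nreg i))
  | .nstore A i a => σ.setNArr A (σ.nreg i) (σ.nreg a)
  | .rconst a q => σ.setR a (q : ℝ)
  | .rcopy a b => σ.setR a (σ.rreg b)
  | .radd a b c => σ.setR a (σ.rreg b + σ.rreg c)
  | .rsub a b c => σ.setR a (σ.rreg b - σ.rreg c)
  | .rmul a b c => σ.setR a (σ.rreg b * σ.rreg c)
  | .rdiv a b c => σ.setR a (σ.rreg b / σ.rreg c)
  | .rload a A i j => σ.setR a (σ.rarr A (σ.nreg i) (σ.nreg j))
  | .rstore A i j a => σ.setRArr A (σ.nreg i) (σ.nreg j) (σ.rreg a)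
  | .unif _ _ => σ
  | .flip _ _ => σ

/-- Instructions that draw no random number. -/
def Instr.IsDet : Instr → Prop
  | .unif _ _ => False
  | .flip _ _ => False
  | _ => True

theorem Instr.IsDet.exec_eq {o : Instr} (h : o.IsDet) (σ : State) :
    o.exec σ = PMF.pure (o.det σ) := by
  cases o <;> first | rfl | exact h.elim

/-- Execute a list of instructions one after the other. -/
def block : List Instr → Prog
  | [] => .skip
  | o :: l => .seq (.op o) (block l)

/-- The effect of a list of instructions that draw no random numbers. -/
noncomputable def execs : List Instr → State → State
  | [], σ => σ
  | o :: l, σ => execs l (o.det σ)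

/-- Each instruction costs one step for itself and one for unfolding `seq`; the last step is the
closing `skip`. -/
theorem Term.block {l : List Instr} {P : State → Prop} (hl : ∀ o ∈ l, o.IsDet) :
    ∀ {σ : State}, P (execs l σ) → Term (block l) σ (2 * l.length + 1) P := by
  induction l with
  | nil => exact fun h => Term.skip h
  | cons o l ih =>
    intro σ h
    refine (Term.seq (P := fun σ' => σ' = o.det σ) (l := 2 * l.length + 1)
      (Term.op ((hl o (by simp)).exec_eq σ) rfl) ?_).mono (by simp; omega) fun _ => id
    rintro _ rfl
    exact ih (fun o ho => hl o (by simp [ho])) h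

theorem Term.block_seq {l : List Instr} {q : Prog} {σ : State} {k : ℕ} {P : State → Prop}
    (hl : ∀ o ∈ l, o.IsDet) (hq : Term q (execs l σ) k P) :
    Term (.seq (RealRAM.block l) q) σ (2 * l.length + 2 + k) P :=
  (Term.seq (P := fun σ' => σ' = execs l σ) (Term.block hl rfl) (fun _ h => h ▸ hq)).mono
    (by omega) fun _ => id

/-! ### Reading memory after a single write. -/

section simp_lemmas

variable (σ : State) (a b A B i j k l : ℕ)

@[simp] theorem State.setN_nreg (v : ℕ) :
    (σ.setN a v).nreg b = if b = a then v else σ.nreg b := by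
  simp [State.setN, Function.update_apply]

@[simp] theorem State.setN_rreg (v : ℕ) : (σ.setN a v).rreg = σ.rreg := rfl
@[simp] theorem State.setN_narr (v : ℕ) : (σ.setN a v).narr = σ.narr := rfl
@[simp] theorem State.setN_rarr (v : ℕ) : (σ.setN a v).rarr = σ.rarr := rfl

@[simp] theorem State.setR_rreg (v : ℝ) :
    (σ.setR a v).rreg b = if b = a then v else σ.rreg b := by
  simp [State.setR, Function.update_apply]

@[simp] theorem State.setR_nreg (v : ℝ) : (σ.setR a v).nreg = σ.nreg := rfl
@[simp] theorem State.setR_narr (v : ℝ) : (σ.setR a v).narr = σ.narr := rfl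
@[simp] theorem State.setR_rarr (v : ℝ) : (σ.setR a v).rarr = σ.rarr := rfl

@[simp] theorem State.setNArr_narr (v : ℕ) :
    (σ.setNArr A i v).narr B j = if B = A ∧ j = i then v else σ.narr B j := by
  simp only [State.setNArr, Function.update_apply]
  split_ifs <;> simp_all

@[simp] theorem State.setNArr_nreg (v : ℕ) : (σ.setNArr A i v).nreg = σ.nreg := rfl
@[simp] theorem State.setNArr_rreg (v : ℕ) : (σ.setNArr A i v).rreg = σ.rreg := rfl
@[simp] theorem State.setNArr_rarr (v : ℕ) : (σ.setNArr A i v).rarr = σ.rarr := rfl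

@[simp] theorem State.setRArr_rarr (v : ℝ) :
    (σ.setRArr A i j v).rarr B k l = if B = A ∧ k = i ∧ l = j then v else σ.rarr B k l := by
  by_cases hB : B = A <;> by_cases hk : k = i <;> by_cases hl : l = j <;>
    simp [State.setRArr, hB, hk, hl]

@[simp] theorem State.setRArr_nreg (v : ℝ) : (σ.setRArr A i j v).nreg = σ.nreg := rfl
@[simp] theorem State.setRArr_rreg (v : ℝ) : (σ.setRArr A i j v).rreg = σ.rreg := rfl
@[simp] theorem State.setRArr_narr (v : ℝ) : (σ.setRArr A i j v).narr = σ.narr := rfl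

end simp_lemmas

/-! ## Halting probabilities -/

/-- The probability that the programs `K`, started on memory `σ`, halt within `t` steps with
memory contents satisfying `Q`. -/
noncomputable def val (Q : State → Prop) (t : ℕ) (K : List Prog) (σ : State) : ℝ :=
  ((run t (K, σ)).toOuterMeasure {c | c.1 = [] ∧ Q c.2}).toReal

variable {Q : State → Prop}

theorem toOuterMeasure_le_one {α : Type*} (p : PMF α) (s : Set α) : p.toOuterMeasure s ≤ 1 := by
  rw [PMF.toOuterMeasure_apply, ← p.tsum_coe]
  exact ENNReal.tsum_le_tsum fun a => Set.indicator_le_self s p a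

theorem val_nonneg (t K σ) : 0 ≤ val Q t K σ := ENNReal.toReal_nonneg

theorem haltProb_eq (p : Prog) (σ : State) (t : ℕ) :
    haltProb p σ t Q = ENNReal.ofReal (val Q t [p] σ) := by
  rw [val, ENNReal.ofReal_toReal ((toOuterMeasure_le_one _ _).trans_lt ENNReal.one_lt_top).ne]
  rfl

/-- Halted configurations are fixed by `step`, so the halted mass can only grow. This allows every
step budget below to be rounded up. -/
theorem run_mono (c : Config) (t : ℕ) :
    (run t c).toOuterMeasure {c | c.1 = [] ∧ Q c.2} ≤
      (run (t + 1) c).toOuterMeasure {c | c.1 = [] ∧ Q c.2} := by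
  induction t generalizing c with
  | zero =>
    obtain ⟨K, σ⟩ := c
    by_cases h : K = []
    · subst h
      rw [run_succ_of_step (c' := ([], σ)) rfl]
    · simp [run, PMF.toOuterMeasure_pure_apply, h]
  | succ t ih =>
    rw [run, run, PMF.toOuterMeasure_bind_apply, PMF.toOuterMeasure_bind_apply]
    exact ENNReal.tsum_le_tsum fun c => mul_le_mul_right (ih c) _

theorem haltProb_mono (p : Prog) (σ : State) : Monotone fun t => haltProb p σ t Q :=
  monotone_nat_of_le_succ fun t => run_mono _ t

theorem val_mono {t t' : ℕ} (h : t ≤ t') (K σ) : val Q t K σ ≤ val Q t' K σ :=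
  ENNReal.toReal_mono ((toOuterMeasure_le_one _ _).trans_lt ENNReal.one_lt_top).ne
    (monotone_nat_of_le_succ (f := fun t => (run t (K, σ)).toOuterMeasure {c | c.1 = [] ∧ Q c.2})
      (fun t => run_mono _ t) h)

theorem val_nil {σ : State} (h : Q σ) (t : ℕ) : val Q t [] σ = 1 := by
  refine le_antisymm (ENNReal.toReal_le_of_le_ofReal zero_le_one
    (by simpa using toOuterMeasure_le_one _ _)) ?_
  refine le_trans ?_ (val_mono (Nat.zero_le t) [] σ)
  simp [val, run, PMF.toOuterMeasure_pure_apply, h]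

/-- Deterministic code costs steps but no probability: a lower bound for the continuation, valid in
every memory that satisfies the postcondition, passes through it. -/
theorem le_val_of_term {p : Prog} {σ : State} {k t t' : ℕ} {P : State → Prop} {K : List Prog}
    {x : ℝ} (hp : Term p σ k P) (h : ∀ σ', P σ' → x ≤ val Q t K σ') (hk : t + k ≤ t') :
    x ≤ val Q t' (p :: K) σ := by
  obtain ⟨σ', h1, j, hj, r⟩ := hp
  refine (h σ' h1).trans (le_trans (le_of_eq ?_) (val_mono (show t + j ≤ t' by omega) _ _))
  rw [val, val, r]

theorem val_of_step {K K' : List Prog} {σ σ' : State} (h : step (K, σ) = PMF.pure (K', σ')) (t : ℕ) :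
    val Q (t + 1) K σ = val Q t K' σ' := by
  rw [val, val, run_succ_of_step h]

theorem val_seq (p q : Prog) (K σ t) : val Q (t + 1) (.seq p q :: K) σ = val Q t (p :: q :: K) σ :=
  val_of_step rfl t

theorem val_cond_true {c : Test} {σ : State} (hc : c.Holds σ) (p q K t) :
    val Q (t + 1) (.cond c p q :: K) σ = val Q t (p :: K) σ :=
  val_of_step (by simp [step, hc]) t

theorem val_cond_false {c : Test} {σ : State} (hc : ¬ c.Holds σ) (p q K t) :
    val Q (t + 1) (.cond c p q :: K) σ = val Q t (q :: K) σ :=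
  val_of_step (by simp [step, hc]) t

theorem val_loop_true {c : Test} {σ : State} (hc : c.Holds σ) (p K t) :
    val Q (t + 1) (.loop c p :: K) σ = val Q t (p :: .loop c p :: K) σ :=
  val_of_step (by simp [step, hc]) t

theorem val_loop_false {c : Test} {σ : State} (hc : ¬ c.Holds σ) (p K t) :
    val Q (t + 1) (.loop c p :: K) σ = val Q t K σ :=
  val_of_step (by simp [step, hc]) t

theorem val_unif {σ : State} {b m : ℕ} (hm : σ.nreg b = m) (h0 : 0 < m) (a K t) :
    val Q (t + 1) (.op (.unif a b) :: K) σ =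
      ∑ v ∈ Finset.range m, (1 / m : ℝ) * val Q t K (σ.setN a v) := by
  obtain ⟨m, rfl⟩ : ∃ k, m = k + 1 := ⟨m - 1, by omega⟩
  have hstep : step (.op (.unif a b) :: K, σ) =
      (PMF.uniformOfFintype (Fin (m + 1))).map fun v : Fin (m + 1) => (K, σ.setN a (v : ℕ)) := by
    rw [step, Instr.exec]
    split
    · omega
    · next k hk =>
      obtain rfl : k = m := by omega
      rw [PMF.map_comp]
      exact PMF.map_comp (fun v : Fin (k + 1) => (v : ℕ)) _ _
  rw [val, run, hstep, PMF.bind_map, PMF.toOuterMeasure_bind_apply, tsum_fintype,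
    ENNReal.toReal_sum, Finset.sum_range]
  · refine Finset.sum_congr rfl fun v _ => ?_
    have hc : ((m : ENNReal) + 1).toReal = m + 1 := by exact_mod_cast ENNReal.toReal_natCast (m + 1)
    rw [ENNReal.toReal_mul]
    simp [val, hc]
  · intro v _
    exact ENNReal.mul_ne_top (PMF.apply_ne_top _ _)
      ((toOuterMeasure_le_one _ _).trans_lt ENNReal.one_lt_top).ne

theorem val_flip {σ : State} {b : ℕ} {p : ℝ} (hp : σ.rreg b = p) (h0 : 0 ≤ p) (h1 : p ≤ 1) (a K t) :
    val Q (t + 1) (.op (.flip a b) :: K) σ =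
      p * val Q t K (σ.setN a 1) + (1 - p) * val Q t K (σ.setN a 0) := by
  have hq : min 1 (σ.rreg b).toNNReal = p.toNNReal := by
    rw [hp]; exact min_eq_right (by simpa using h1)
  have hstep : step (.op (.flip a b) :: K, σ) =
      (coin (min 1 (σ.rreg b).toNNReal) (min_le_left _ _)).map
        fun v => (K, σ.setN a (if v then 1 else 0)) := by
    simp [step, Instr.exec, PMF.map_comp, Function.comp_def]
  rw [val, run, hstep, PMF.bind_map, PMF.toOuterMeasure_bind_apply, tsum_fintype,
    ENNReal.toReal_sum]
  · have h2 : ENNReal.ofReal p ≤ 1 := by simpa using h1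
    simp only [Fintype.sum_bool, ENNReal.toReal_mul, coin, PMF.ofFintype_apply, hq]
    simp [val, h0, ENNReal.toReal_sub_of_le, h2, ← ENNReal.ofReal.eq_1]
  · intro v _
    exact ENNReal.mul_ne_top (PMF.apply_ne_top _ _)
      ((toOuterMeasure_le_one _ _).trans_lt ENNReal.one_lt_top).ne

end RealRAM

/-! ## Rank-one updates of positive definite matrices -/

namespace VolumeSampling

open Matrix

variable {d n : ℕ}

/-- The matrix determinant lemma for the column `c • v` and the row `v`; the remaining determinant
has size one. -/
theorem det_add_smul_vecMulVec {A : Matrix (Fin d) (Fin d) ℝ} (hA : IsUnit A.det)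
    (v : Fin d → ℝ) (c : ℝ) :
    (A + c • vecMulVec v v).det = A.det * (1 + c * (v ⬝ᵥ (A⁻¹ *ᵥ v))) := by
  have h := det_add_replicateCol_mul_replicateRow (ι := Unit) hA (c • v) v
  rw [show A + c • vecMulVec v v = A + replicateCol Unit (c • v) * replicateRow Unit v by
    ext i j; simp [vecMulVec_apply, Matrix.mul_apply], h]
  congr 1
  rw [Matrix.mul_assoc]
  simp [Matrix.det_unique, Matrix.mul_apply, dotProduct, mulVec, Finset.mul_sum]

/-- The Sherman–Morrison formula for symmetric matrices. -/
theorem inv_add_smul_vecMulVec {A : Matrix (Fin d) (Fin d) ℝ} (hA : A.PosDef) (v : Fin d → ℝ)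
    (c : ℝ) (hc : 1 + c * (v ⬝ᵥ (A⁻¹ *ᵥ v)) ≠ 0) :
    (A + c • vecMulVec v v)⁻¹ = A⁻¹ -
      (c / (1 + c * (v ⬝ᵥ (A⁻¹ *ᵥ v)))) • vecMulVec (A⁻¹ *ᵥ v) (A⁻¹ *ᵥ v) := by
  have hu : IsUnit A.det := hA.det_pos.ne'.isUnit
  have hs : A⁻¹ᵀ = A⁻¹ := by
    have := hA.inv.isHermitian
    rwa [Matrix.IsHermitian, conjTranspose_eq_transpose_of_trivial] at this
  apply inv_eq_right_inv
  set w := A⁻¹ *ᵥ v with hw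
  set q := v ⬝ᵥ w
  have h1 : A *ᵥ w = v := by rw [hw, mulVec_mulVec, mul_nonsing_inv _ hu, one_mulVec]
  have h2 : v ᵥ* A⁻¹ = w := by rw [hw, ← vecMul_transpose, hs]
  have e1 : A * vecMulVec w w = vecMulVec v w := by rw [mul_vecMulVec, h1]
  have e2 : vecMulVec v v * A⁻¹ = vecMulVec v w := by rw [vecMulVec_mul, h2]
  have e3 : vecMulVec v v * vecMulVec w w = q • vecMulVec v w := by
    rw [vecMulVec_mul_vecMulVec, vecMulVec_smul]
  rw [Matrix.add_mul, Matrix.mul_sub, Matrix.mul_sub, mul_nonsing_inv _ hu, Matrix.mul_smul, e1,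
    Matrix.smul_mul, e2, Matrix.smul_mul, Matrix.mul_smul, e3]
  ext i j
  simp only [Matrix.add_apply, Matrix.sub_apply, Matrix.smul_apply, smul_eq_mul]
  field_simp
  ring

/-- The factor is a quotient of two positive determinants. It is the Sherman–Morrison denominator,
so updates between positive definite matrices never divide by zero. -/
theorem one_add_mul_pos {A : Matrix (Fin d) (Fin d) ℝ} (hA : A.PosDef) (v : Fin d → ℝ)
    (c : ℝ) (hB : (A + c • vecMulVec v v).PosDef) : 0 < 1 + c * (v ⬝ᵥ (A⁻¹ *ᵥ v)) := by
  have h := hB.det_pos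
  rw [det_add_smul_vecMulVec hA.det_pos.ne'.isUnit] at h
  exact pos_of_mul_pos_right h hA.det_pos.le

/-! ## Gram matrices and leverage scores -/

/-- `X_S X_Sᵀ + lam I`. -/
noncomputable def regGram (X : Matrix (Fin d) (Fin n) ℝ) (lam : ℝ) (S : Finset (Fin n)) :
    Matrix (Fin d) (Fin d) ℝ :=
  cols X S * (cols X S)ᵀ + lam • (1 : Matrix (Fin d) (Fin d) ℝ)

theorem regDet_eq (X : Matrix (Fin d) (Fin n) ℝ) (lam : ℝ) (S : Finset (Fin n)) :
    regDet X lam S = (regGram X lam S).det := rfl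

theorem regGram_eq_sum (X : Matrix (Fin d) (Fin n) ℝ) (lam : ℝ) (S : Finset (Fin n)) :
    regGram X lam S = ∑ i ∈ S, vecMulVec (X.col i) (X.col i) + lam • 1 := by
  ext a b
  simp only [regGram, cols, Matrix.add_apply, Matrix.mul_apply, Matrix.sum_apply, vecMulVec_apply,
    submatrix_apply, transpose_apply, id, col_apply]
  rw [Finset.sum_coe_sort S (fun i => X a i * X b i)]

theorem regGram_erase (X : Matrix (Fin d) (Fin n) ℝ) (lam : ℝ) {S : Finset (Fin n)} {i : Fin n}
    (hi : i ∈ S) :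
    regGram X lam (S.erase i) = regGram X lam S + (-1 : ℝ) • vecMulVec (X.col i) (X.col i) := by
  rw [regGram_eq_sum, regGram_eq_sum, ← Finset.add_sum_erase S _ hi]
  simp only [neg_smul, one_smul]
  abel

theorem posSemidef_vecMulVec (v : Fin d → ℝ) : (vecMulVec v v).PosSemidef := by
  simpa using posSemidef_vecMulVec_self_star v

theorem regGram_posSemidef (X : Matrix (Fin d) (Fin n) ℝ) {lam : ℝ} (hl : 0 ≤ lam)
    (S : Finset (Fin n)) : (regGram X lam S).PosSemidef := by
  rw [regGram_eq_sum]
  exact (posSemidef_sum S fun i _ => posSemidef_vecMulVec _).add (PosSemidef.one.smul hl)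

/-- `X Xᵀ` plus a nonnegative diagonal matrix is positive definite if `X` has full row rank or
the diagonal is positive. -/
theorem posDef_gram_add_diagonal (X : Matrix (Fin d) (Fin n) ℝ) (v : Fin d → ℝ) (hv : ∀ i, 0 ≤ v i)
    (h : (∀ i, 0 < v i) ∨ X.rank = d) : (X * Xᵀ + diagonal v).PosDef := by
  have hX : (X * Xᵀ).PosSemidef := by
    simpa using posSemidef_self_mul_conjTranspose X
  rcases h with h | h
  · exact PosDef.posSemidef_add hX (PosDef.diagonal h)
  · refine PosDef.add_posSemidef ?_ (PosSemidef.diagonal hv)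
    -- `X Xᵀ` has the rank of `X`, namely `d`, hence is invertible; for a positive semidefinite
    -- matrix this is positive definiteness.
    rw [hX.posDef_iff_isUnit]
    have hr : (X * Xᵀ).rank = Fintype.card (Fin d) := by
      rw [rank_self_mul_transpose, h, Fintype.card_fin]
    rw [← mulVec_surjective_iff_isUnit, ← coe_mulVecLin, ← LinearMap.range_eq_top]
    exact Submodule.eq_top_of_finrank_eq (hr.trans (by simp))

theorem regGram_univ (X : Matrix (Fin d) (Fin n) ℝ) (lam : ℝ) :
    regGram X lam Finset.univ = X * Xᵀ + diagonal fun _ => lam := by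
  ext a b
  rw [regGram_eq_sum]
  simp [Matrix.mul_apply, Matrix.sum_apply, vecMulVec_apply, diagonal_apply, one_apply]

/-- The probability with which a uniformly proposed `i ∈ S` is removed: `1 - xᵢᵀ A_S⁻¹ xᵢ`. -/
noncomputable def lev (X : Matrix (Fin d) (Fin n) ℝ) (lam : ℝ) (S : Finset (Fin n)) (i : Fin n) :
    ℝ :=
  1 - X.col i ⬝ᵥ ((regGram X lam S)⁻¹ *ᵥ X.col i)

variable {X : Matrix (Fin d) (Fin n) ℝ} {lam : ℝ} {S : Finset (Fin n)} {i : Fin n}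

/-- The determinant lemma with `c = -1`. It replaces the determinant ratio in the sampling law by a
quadratic form in the inverse. -/
theorem regDet_erase (hS : (regGram X lam S).PosDef) (hi : i ∈ S) :
    regDet X lam (S.erase i) = regDet X lam S * lev X lam S i := by
  rw [regDet_eq, regGram_erase X lam hi, det_add_smul_vecMulVec hS.det_pos.ne'.isUnit, lev,
    regDet_eq]
  ring

theorem removalWeight_eq_lev (hS : (regGram X lam S).PosDef) (hi : i ∈ S) :
    removalWeight X lam S i = lev X lam S i := by
  rw [removalWeight, regDet_erase hS hi, mul_div_cancel_left₀]
  exact hS.det_pos.ne'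

theorem lev_nonneg (hl : 0 ≤ lam) (hS : (regGram X lam S).PosDef) (hi : i ∈ S) :
    0 ≤ lev X lam S i := by
  rw [← removalWeight_eq_lev hS hi]
  exact div_nonneg (regGram_posSemidef X hl _).det_nonneg hS.det_pos.le

theorem lev_le_one (hS : (regGram X lam S).PosDef) : lev X lam S i ≤ 1 := by
  have := hS.inv.posSemidef.dotProduct_mulVec_nonneg (X.col i)
  simp only [star_trivial] at this
  rw [lev]
  linarith

/-- A semidefinite matrix with nonzero determinant is definite. When `lam = 0` a removal of weight
zero would produce a singular matrix, so definiteness is propagated only along removals of positive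
weight. -/
theorem posDef_erase (hl : 0 ≤ lam) (hS : (regGram X lam S).PosDef) (hi : i ∈ S)
    (h : 0 < lev X lam S i) : (regGram X lam (S.erase i)).PosDef := by
  rw [(regGram_posSemidef X hl _).posDef_iff_det_ne_zero, ← regDet_eq, regDet_erase hS hi]
  exact (mul_pos hS.det_pos h).ne'

theorem posDef_of_pos (hl : 0 < lam) (S : Finset (Fin n)) : (regGram X lam S).PosDef := by
  rw [regGram_eq_sum]
  exact PosDef.posSemidef_add (posSemidef_sum S fun i _ => posSemidef_vecMulVec _)
    (PosDef.one.smul hl)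

/-- The inverse after removing a column. -/
theorem inv_erase (hS : (regGram X lam S).PosDef) (hi : i ∈ S) (h : lev X lam S i ≠ 0) :
    (regGram X lam (S.erase i))⁻¹ = (regGram X lam S)⁻¹ - (-1 / lev X lam S i) •
      vecMulVec ((regGram X lam S)⁻¹ *ᵥ X.col i) ((regGram X lam S)⁻¹ *ᵥ X.col i) := by
  have e : 1 + -1 * (X.col i ⬝ᵥ ((regGram X lam S)⁻¹ *ᵥ X.col i)) = lev X lam S i := by
    rw [lev]; ring
  rw [regGram_erase X lam hi, inv_add_smul_vecMulVec hS _ _ (by rwa [e]), e]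

/-- Sherman–Morrison evaluated at `xⱼ`: since `A_S⁻¹ xᵢ` is already stored, refreshing one weight
costs a single inner product. -/
theorem lev_erase (hS : (regGram X lam S).PosDef) (hi : i ∈ S) (h : lev X lam S i ≠ 0)
    (j : Fin n) :
    lev X lam (S.erase i) j = lev X lam S j + (-1 / lev X lam S i) *
      (X.col j ⬝ᵥ ((regGram X lam S)⁻¹ *ᵥ X.col i)) ^ 2 := by
  rw [lev, inv_erase hS hi h, sub_mulVec, dotProduct_sub, smul_mulVec, dotProduct_smul,
    vecMulVec_mulVec, lev.eq_1 X lam S j]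
  simp only [op_smul_eq_smul, dotProduct_smul, smul_eq_mul]
  rw [dotProduct_comm _ (X.col j)]
  ring

/-- By linearity of the trace, `∑ xᵢᵀ A⁻¹ xᵢ = tr (A⁻¹ (A - lam I)) = d - lam tr A⁻¹`. -/
theorem sum_lev (hS : (regGram X lam S).PosDef) :
    ∑ i ∈ S, lev X lam S i = S.card - d + lam * ((regGram X lam S)⁻¹).trace := by
  have h1 : ∑ i ∈ S, X.col i ⬝ᵥ ((regGram X lam S)⁻¹ *ᵥ X.col i) =
      ((regGram X lam S)⁻¹ * (regGram X lam S - lam • 1)).trace := by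
    rw [show regGram X lam S - lam • 1 = ∑ i ∈ S, vecMulVec (X.col i) (X.col i) by
      rw [regGram_eq_sum, add_sub_cancel_right], Finset.mul_sum, trace_sum]
    refine Finset.sum_congr rfl fun i _ => ?_
    rw [mul_vecMulVec, trace_vecMulVec, dotProduct_comm]
  simp only [lev]
  rw [Finset.sum_sub_distrib, h1, mul_sub, nonsing_inv_mul _ hS.det_pos.ne'.isUnit, trace_sub]
  simp
  ring

theorem card_sub_le_sum_lev (hl : 0 ≤ lam) (hS : (regGram X lam S).PosDef) :
    (S.card - d : ℝ) ≤ ∑ i ∈ S, lev X lam S i := by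
  rw [sum_lev hS]
  have := mul_nonneg hl hS.inv.posSemidef.trace_nonneg
  linarith

/-- With `lam > 0` every weight is a quotient of positive determinants; otherwise the trace bound
`|S| - d` is already positive. -/
theorem sum_lev_pos (hl : 0 ≤ lam) (hS : (regGram X lam S).PosDef) (h : 0 < lam ∨ d < S.card)
    (hne : S.Nonempty) : 0 < ∑ i ∈ S, lev X lam S i := by
  rcases h with h | h
  · refine Finset.sum_pos (fun i hi => ?_) hne
    rw [← removalWeight_eq_lev hS hi]
    exact div_pos (posDef_of_pos h _).det_pos hS.det_pos
  · have : (d : ℝ) < S.card := by exact_mod_cast h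
    have := card_sub_le_sum_lev hl hS
    linarith

/-! ## The law of volume sampling, conditioned on the current set -/

open Classical in
/-- The probability that `k` further removals lead from `S` to a set satisfying `R`. -/
noncomputable def condProb (X : Matrix (Fin d) (Fin n) ℝ) (lam : ℝ) (R : Finset (Fin n) → Prop) :
    ℕ → Finset (Fin n) → ℝ
  | 0, S => if R S then 1 else 0
  | k + 1, S => ∑ i ∈ S, removalProb X lam S i * condProb X lam R k (S.erase i)

/-- Both sides sum over one removal, indexed on the left by the set before it and on the right by
the set after it; `(S, i) ↦ (S.erase i, i)` matches the indices. Iteration links the forward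
recursion `probAfter` to the backward recursion `condProb`. -/
theorem sum_probAfter_mul_condProb (R : Finset (Fin n) → Prop) (k j : ℕ) :
    ∑ S, probAfter X lam k S * condProb X lam R (j + 1) S =
      ∑ S, probAfter X lam (k + 1) S * condProb X lam R j S := by
  simp only [condProb, probAfter, Finset.mul_sum, Finset.sum_mul]
  rw [Finset.sum_sigma', Finset.sum_sigma']
  refine Finset.sum_bij' (fun x _ => ⟨x.1.erase x.2, x.2⟩) (fun x _ => ⟨insert x.2 x.1, x.2⟩)
    ?_ ?_ ?_ ?_ ?_
  · simp
  · simp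
  · rintro ⟨S, i⟩ h
    simp only [Finset.mem_sigma, Finset.mem_univ, true_and] at h
    simp [Finset.insert_erase h]
  · rintro ⟨S, i⟩ h
    simp only [Finset.mem_sigma, Finset.mem_univ, true_and, Finset.mem_compl] at h
    simp [Finset.erase_insert h]
  · rintro ⟨S, i⟩ h
    simp only [Finset.mem_sigma, Finset.mem_univ, true_and] at h
    simp only [Finset.insert_erase h]
    ring

theorem condProb_univ (R : Finset (Fin n) → Prop) (k j : ℕ) :
    ∑ S, probAfter X lam k S * condProb X lam R j S = condProb X lam R (k + j) Finset.univ := by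
  induction k generalizing j with
  | zero => simp [probAfter]
  | succ k ih => rw [← sum_probAfter_mul_condProb, ih, add_right_comm, add_assoc]

theorem condProb_eq_univ (k : ℕ) (T : Finset (Fin n)) :
    condProb X lam (fun S => S = T) k Finset.univ = probAfter X lam k T := by
  rw [← add_zero k, ← condProb_univ]
  simp [condProb]

theorem removalProb_eq (hS : (regGram X lam S).PosDef) (hi : i ∈ S) :
    removalProb X lam S i = lev X lam S i / ∑ j ∈ S, lev X lam S j := by
  rw [removalProb, removalWeight_eq_lev hS hi,
    Finset.sum_congr rfl fun j hj => removalWeight_eq_lev hS hj]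

theorem condProb_nonneg_le_one (hl : 0 ≤ lam) (R : Finset (Fin n) → Prop) (k : ℕ)
    {S : Finset (Fin n)} (hS : (regGram X lam S).PosDef) :
    0 ≤ condProb X lam R k S ∧ condProb X lam R k S ≤ 1 := by
  induction k generalizing S with
  | zero => simp only [condProb]; split_ifs <;> simp
  | succ k ih =>
    have hw : ∀ i ∈ S, removalProb X lam S i = lev X lam S i / ∑ j ∈ S, lev X lam S j :=
      fun i hi => removalProb_eq hS hi
    have h0 : ∀ i ∈ S, 0 ≤ removalProb X lam S i := fun i hi => by
      rw [hw i hi]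
      exact div_nonneg (lev_nonneg hl hS hi) (Finset.sum_nonneg fun j hj => lev_nonneg hl hS hj)
    have key : ∀ i ∈ S, 0 ≤ removalProb X lam S i * condProb X lam R k (S.erase i) ∧
        removalProb X lam S i * condProb X lam R k (S.erase i) ≤ removalProb X lam S i := by
      intro i hi
      -- After a removal of weight zero the Gram matrix may be singular and the induction hypothesis
      -- unavailable, but the factor zero makes the value irrelevant.
      rcases (lev_nonneg hl hS hi).eq_or_lt with h | h
      · simp [hw i hi, ← h]
      · have := ih (posDef_erase hl hS hi h)
        exact ⟨mul_nonneg (h0 i hi) this.1, mul_le_of_le_one_right (h0 i hi) this.2⟩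
    refine ⟨Finset.sum_nonneg fun i hi => (key i hi).1,
      (Finset.sum_le_sum fun i hi => (key i hi).2).trans ?_⟩
    rw [Finset.sum_congr rfl hw, ← Finset.sum_div]
    -- The total weight may vanish here; the quotient is then `0`, whence an inequality and not an
    -- equality.
    exact div_self_le_one _

/-- The recursion with its denominator cleared. Both samplers produce the unnormalized weights
`lev`, and this identity shows that they have the right conditional law. -/
theorem sum_lev_mul_condProb (R : Finset (Fin n) → Prop) (k : ℕ) (hS : (regGram X lam S).PosDef)
    (hpos : 0 < ∑ i ∈ S, lev X lam S i) :
    ∑ i ∈ S, lev X lam S i * condProb X lam R k (S.erase i) =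
      (∑ i ∈ S, lev X lam S i) * condProb X lam R (k + 1) S := by
  rw [condProb, Finset.mul_sum]
  refine Finset.sum_congr rfl fun i hi => ?_
  rw [removalProb_eq hS hi]
  field_simp

/-- The normalizer never vanishes: if `lam` is not positive, then `d ≤ s < |S|` before each removal.
Hence volume sampling has total mass one. -/
theorem condProb_true {s : ℕ} (hl : 0 ≤ lam) (had : 0 < lam ∨ d ≤ s) (k : ℕ)
    {S : Finset (Fin n)} (hS : (regGram X lam S).PosDef) (hk : S.card = s + k) :
    condProb X lam (fun _ => True) k S = 1 := by
  induction k generalizing S with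
  | zero => simp [condProb]
  | succ k ih =>
    have hpos : 0 < ∑ i ∈ S, lev X lam S i :=
      sum_lev_pos hl hS (had.imp_right fun h => by omega) (Finset.card_pos.1 (by omega))
    have h := sum_lev_mul_condProb (fun _ => True) k hS hpos
    rw [Finset.sum_congr rfl (g := fun i => lev X lam S i)] at h
    · exact (mul_left_cancel₀ hpos.ne' (by linarith)).symm
    · intro i hi
      rcases (lev_nonneg hl hS hi).eq_or_lt with h | h
      · rw [← h, zero_mul]
      · rw [ih (posDef_erase hl hS hi h) (by rw [Finset.card_erase_of_mem hi]; omega), mul_one]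

end VolumeSampling

namespace RealRAM

open Matrix

/-! ## Matrix subroutines

Integer registers `0` to `9` and real registers `0` to `9` hold the persistent data of the
sampler; registers from `10` on are scratch registers of the subroutines below. Integer
register `1` holds the dimension, `4` the constant one, `5` the constant zero, `8` the index of the
current column; real array `0` holds the columns, `1` the inverse matrix, `3` its product with
the current column. -/

/-- Real array `3` receives the product of the matrix in array `1` with the current column, and
real register `2` the value of the quadratic form at the current column. -/
def quadProg : Prog :=
  .seq (block [.rconst 2 0, .nconst 10 0])
    (.loop (.nlt 10 1)
      (.seq
        (.seq (block [.rconst 12 0, .nconst 11 0])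
          (.loop (.nlt 11 1)
            (block [.rload 10 1 10 11, .rload 11 0 11 8, .rmul 10 10 11, .radd 12 12 10,
              .nadd 11 11 4])))
        (block [.rstore 3 10 5 12, .rload 10 0 10 8, .rmul 10 10 12, .radd 2 2 10,
          .nadd 10 10 4])))

/-- Subtract from the matrix in array `1` the outer square of the vector in array `3` times
the content of real register `3`. -/
def updateProg : Prog :=
  .seq (block [.nconst 10 0])
    (.loop (.nlt 10 1)
      (.seq
        (.seq (block [.rload 12 3 10 5, .rmul 12 12 3, .nconst 11 0])
          (.loop (.nlt 11 1)
            (block [.rload 10 3 11 5, .rmul 10 10 12, .rload 11 1 10 11, .rsub 11 11 10,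
              .rstore 1 10 11 11, .nadd 11 11 4])))
        (block [.nadd 10 10 4])))

/-- The matrix stored in array `1`. -/
def matOf (d : ℕ) (σ : State) : Matrix (Fin d) (Fin d) ℝ := Matrix.of fun a b => σ.rarr 1 a b

/-- The column with index `j` stored in array `0`. -/
def colOf (d : ℕ) (σ : State) (j : ℕ) : Fin d → ℝ := fun a => σ.rarr 0 a j

/-- The vector stored in array `3`. -/
def vecOf (d : ℕ) (σ : State) : Fin d → ℝ := fun a => σ.rarr 3 a 0

/-! ### Which memory the matrix subroutines leave alone. -/

/-- The persistent data that no matrix subroutine changes. -/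
structure Frame (σ τ : State) : Prop where
  narr : τ.narr = σ.narr
  nreg : ∀ a < 10, τ.nreg a = σ.nreg a
  rreg : ∀ a < 10, a ≠ 2 → τ.rreg a = σ.rreg a
  rarr : ∀ A, A ≠ 1 → A ≠ 3 → ∀ i j, τ.rarr A i j = σ.rarr A i j

theorem Frame.refl (σ : State) : Frame σ σ := ⟨rfl, by simp, by simp, by simp⟩

theorem Frame.trans {σ τ υ : State} (h : Frame σ τ) (h' : Frame τ υ) : Frame σ υ :=
  ⟨h'.narr.trans h.narr, fun a ha => (h'.nreg a ha).trans (h.nreg a ha),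
    fun a ha h2 => (h'.rreg a ha h2).trans (h.rreg a ha h2),
    fun A h1 h3 i j => (h'.rarr A h1 h3 i j).trans (h.rarr A h1 h3 i j)⟩

theorem Frame.colOf {σ τ : State} (h : Frame σ τ) (d j : ℕ) : colOf d τ j = colOf d σ j :=
  funext fun a => h.rarr 0 (by norm_num) (by norm_num) a j

/-- The constants the subroutines rely on. -/
structure Consts (d : ℕ) (σ : State) : Prop where
  dim : σ.nreg 1 = d
  one : σ.nreg 4 = 1
  zero : σ.nreg 5 = 0

theorem Consts.frame {d : ℕ} {σ τ : State} (h : Consts d σ) (h' : Frame σ τ) : Consts d τ :=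
  ⟨(h'.nreg 1 (by norm_num)).trans h.dim, (h'.nreg 4 (by norm_num)).trans h.one,
    (h'.nreg 5 (by norm_num)).trans h.zero⟩

/-- Deterministic instructions that respect `Frame`. -/
def Instr.Scratch : Instr → Prop
  | .nconst a _ | .ncopy a _ | .nadd a _ _ | .nsub a _ _ | .nload a _ _ => 10 ≤ a
  | .rconst a _ | .rcopy a _ | .radd a _ _ | .rsub a _ _ | .rmul a _ _ | .rdiv a _ _
  | .rload a _ _ _ => 10 ≤ a ∨ a = 2
  | .rstore A _ _ _ => A = 1 ∨ A = 3
  | .nstore _ _ _ | .unif _ _ | .flip _ _ => False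

theorem Frame.setN (σ : State) {a : ℕ} (ha : 10 ≤ a) (v : ℕ) : Frame σ (σ.setN a v) :=
  ⟨rfl, fun b hb => by simp [show b ≠ a by omega], fun _ _ _ => rfl, fun _ _ _ _ _ => rfl⟩

theorem Frame.setR (σ : State) {a : ℕ} (ha : 10 ≤ a ∨ a = 2) (v : ℝ) : Frame σ (σ.setR a v) :=
  ⟨rfl, fun _ _ => rfl, fun b hb h2 => by simp [show b ≠ a by omega], fun _ _ _ _ _ => rfl⟩

theorem Frame.setRArr (σ : State) {A : ℕ} (hA : A = 1 ∨ A = 3) (i j : ℕ) (v : ℝ) :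
    Frame σ (σ.setRArr A i j v) :=
  ⟨rfl, fun _ _ => rfl, fun _ _ _ => rfl, fun B h1 h3 k l => by simp [show B ≠ A by omega]⟩

theorem Instr.Scratch.frame {o : Instr} (h : o.Scratch) (σ : State) : Frame σ (o.det σ) := by
  cases o <;>
    first
    | exact Frame.setN σ h _
    | exact Frame.setR σ h _
    | exact Frame.setRArr σ h _ _ _
    | exact h.elim

theorem Frame.execs {l : List Instr} (hl : ∀ o ∈ l, o.Scratch) {σ τ : State} (h : Frame σ τ) :
    Frame σ (execs l τ) := by
  induction l generalizing τ with
  | nil => exact h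
  | cons o l ih =>
    exact ih (fun o ho => hl o (by simp [ho])) (h.trans ((hl o (by simp)).frame τ))

theorem term_quadProg {d : ℕ} {σ : State} (hσ : Consts d σ) (hd : 0 < d) :
    Term quadProg σ (60 * d ^ 2) fun τ => Frame σ τ ∧ (∀ i j, τ.rarr 1 i j = σ.rarr 1 i j) ∧
      vecOf d τ = matOf d σ *ᵥ colOf d σ (σ.nreg 8) ∧
      τ.rreg 2 = colOf d σ (σ.nreg 8) ⬝ᵥ (matOf d σ *ᵥ colOf d σ (σ.nreg 8)) := by
  set j := σ.nreg 8 with hj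
  set w : ℕ → ℝ := fun a => ∑ k ∈ Finset.range d, σ.rarr 1 a k * σ.rarr 0 k j with hw
  -- After `i` rows, the first `i` entries of the product are stored and real register `2` holds the
  -- corresponding partial sum of the quadratic form, so one sweep computes both.
  let I : ℕ → State → Prop := fun i τ => Frame σ τ ∧ (∀ i j, τ.rarr 1 i j = σ.rarr 1 i j) ∧
    τ.nreg 10 = i ∧ τ.rreg 2 = ∑ a ∈ Finset.range i, σ.rarr 0 a j * w a ∧
    ∀ a < i, τ.rarr 3 a 0 = w a
  have hinner : ∀ i τ, I i τ → Term (.seq (block [.rconst 12 0, .nconst 11 0])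
      (.loop (.nlt 11 1) (block [.rload 10 1 10 11, .rload 11 0 11 8, .rmul 10 10 11,
        .radd 12 12 10, .nadd 11 11 4]))) τ (12 * d + 7) fun υ => I i υ ∧ υ.rreg 12 = w i := by
    intro i τ ⟨f, h1, h2, h3, h4⟩
    refine (Term.seq (P := fun υ => I i υ ∧ υ.nreg 11 = 0 ∧ υ.rreg 12 = 0) (k := 5)
      (Term.block (by simp [Instr.IsDet]) ?_) fun υ hυ => Term.loop (k := 11) (N := d)
        (fun k υ => I i υ ∧ υ.nreg 11 = k ∧
          υ.rreg 12 = ∑ k ∈ Finset.range k, σ.rarr 1 i k * σ.rarr 0 k j) ?_ ?_ ?_).mono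
      (by omega) ?_
    · refine ⟨⟨f.execs (by simp [Instr.Scratch]), ?_, ?_, ?_, ?_⟩, ?_, ?_⟩
      · simpa [execs, Instr.det]
      · simpa [execs, Instr.det]
      · simpa [execs, Instr.det]
      · simpa [execs, Instr.det]
      · simp [execs, Instr.det]
      · simp [execs, Instr.det]
    · rintro k υ hk ⟨hI, h11, -⟩
      simp [Test.Holds, h11, (hσ.frame hI.1).dim]
    · rintro k υ hk ⟨⟨f, h1, h2, h3, h4⟩, h11, h12⟩
      have hc := hσ.frame f
      refine (Term.block (by simp [Instr.IsDet]) ?_).mono (k := 11) le_rfl fun _ => id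
      refine ⟨⟨f.execs (by simp [Instr.Scratch]), ?_, ?_, ?_, ?_⟩, ?_, ?_⟩
      · simpa [execs, Instr.det]
      · simpa [execs, Instr.det]
      · simpa [execs, Instr.det]
      · simpa [execs, Instr.det]
      · simp [execs, Instr.det, h11, hc.one]
      · simp [execs, Instr.det, h11, h12, h2, h1, Finset.sum_range_succ,
          f.nreg 8 (by norm_num), f.rarr 0 (by norm_num) (by norm_num), hj]
    · simpa using hυ
    · rintro υ ⟨h, -, h'⟩
      exact ⟨h, h'⟩
  refine (Term.seq (P := I 0) (k := 5) (Term.block (by simp [Instr.IsDet]) ?_) fun υ hυ =>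
    -- The exact count is `12 d² + 20 d + 7`; `d ≥ 1` absorbs the lower-order terms.
    Term.loop (N := d) (k := 12 * d + 19) I ?_ ?_ hυ).mono (by nlinarith) ?_
  · refine ⟨(Frame.refl σ).execs (by simp [Instr.Scratch]), ?_, ?_, ?_, ?_⟩ <;>
      simp [execs, Instr.det]
  · rintro i υ hi ⟨f, h1, h2, -⟩
    simp [Test.Holds, h2, (hσ.frame f).dim]
  · intro i τ hi hτ
    refine (Term.seq (hinner i τ hτ) fun υ hυ => Term.block (by simp [Instr.IsDet]) ?_).mono
      le_rfl fun _ => id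
    obtain ⟨⟨f, h1, h2, h3, h4⟩, h12⟩ := hυ
    have hc := hσ.frame f
    refine ⟨f.execs (by simp [Instr.Scratch]), ?_, ?_, ?_, ?_⟩
    · simpa [execs, Instr.det]
    · simp [execs, Instr.det, h2, hc.one]
    · simp [execs, Instr.det, h2, h3, h12, Finset.sum_range_succ,
        f.nreg 8 (by norm_num), f.rarr 0 (by norm_num) (by norm_num), hj]
    · intro a ha
      rcases Nat.lt_succ_iff_lt_or_eq.1 ha with h | rfl
      · simp [execs, Instr.det, h2, h.ne, h4 a h]
      · simp [execs, Instr.det, h2, hc.zero, h12]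
  · rintro υ ⟨f, h1, h2, h3, h4⟩
    refine ⟨f, h1, ?_, ?_⟩
    · ext a
      simp [vecOf, h4, hw, Finset.sum_range, mulVec, dotProduct, matOf, colOf]
    · simp [h3, hw, Finset.sum_range, mulVec, dotProduct, matOf, colOf]

theorem term_updateProg {d : ℕ} {σ : State} (hσ : Consts d σ) (hd : 0 < d) :
    Term updateProg σ (60 * d ^ 2) fun τ => Frame σ τ ∧ (∀ i j, τ.rarr 3 i j = σ.rarr 3 i j) ∧
      τ.rreg 2 = σ.rreg 2 ∧
      matOf d τ = matOf d σ - σ.rreg 3 • vecMulVec (vecOf d σ) (vecOf d σ) := by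
  set u : ℕ → ℕ → ℝ := fun a b => σ.rarr 1 a b - σ.rarr 3 b 0 * (σ.rarr 3 a 0 * σ.rreg 3) with hu
  -- Rows before `i`, and the first `k` entries of row `i`, are already updated. Updating in place
  -- is safe because each new entry depends on no other entry of the matrix.
  let I : ℕ → ℕ → State → Prop := fun i k τ => Frame σ τ ∧
    (∀ i j, τ.rarr 3 i j = σ.rarr 3 i j) ∧ τ.rreg 2 = σ.rreg 2 ∧
    τ.nreg 10 = i ∧ ∀ a < d, ∀ b < d, τ.rarr 1 a b =
      if a < i ∨ a = i ∧ b < k then u a b else σ.rarr 1 a b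
  have hinner : ∀ i τ, i < d → I i 0 τ → Term
      (.seq (block [.rload 12 3 10 5, .rmul 12 12 3, .nconst 11 0])
        (.loop (.nlt 11 1) (block [.rload 10 3 11 5, .rmul 10 10 12, .rload 11 1 10 11,
          .rsub 11 11 10, .rstore 1 10 11 11, .nadd 11 11 4]))) τ (14 * d + 9) (I i d) := by
    intro i τ hi ⟨f, h3, h2, h10, h1⟩
    have hc := hσ.frame f
    refine (Term.seq (P := fun υ => I i 0 υ ∧ υ.nreg 11 = 0 ∧
      υ.rreg 12 = σ.rarr 3 i 0 * σ.rreg 3) (k := 7)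
      (Term.block (by simp [Instr.IsDet]) ?_) fun υ hυ => Term.loop (k := 13) (N := d)
        (fun k υ => I i k υ ∧ υ.nreg 11 = k ∧ υ.rreg 12 = σ.rarr 3 i 0 * σ.rreg 3)
        ?_ ?_ ?_).mono (by omega) ?_
    · refine ⟨⟨f.execs (by simp [Instr.Scratch]), ?_, ?_, ?_, ?_⟩, ?_, ?_⟩
      · simpa [execs, Instr.det]
      · simpa [execs, Instr.det]
      · simpa [execs, Instr.det]
      · simpa [execs, Instr.det] using h1
      · simp [execs, Instr.det]
      · simp [execs, Instr.det, h10, hc.zero, h3, f.rreg 3 (by norm_num) (by norm_num)]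
    · rintro k υ hk ⟨hI, h11, -⟩
      simp [Test.Holds, h11, (hσ.frame hI.1).dim]
    · rintro k υ hk ⟨⟨f, h3, h2, h10, h1⟩, h11, h12⟩
      have hc := hσ.frame f
      refine (Term.block (by simp [Instr.IsDet]) ?_).mono (k := 13) le_rfl fun _ => id
      refine ⟨⟨f.execs (by simp [Instr.Scratch]), ?_, ?_, ?_, ?_⟩, ?_, ?_⟩
      · simpa [execs, Instr.det]
      · simpa [execs, Instr.det]
      · simpa [execs, Instr.det]
      · intro a ha b hb
        have hik := h1 i hi k hk
        simp only [lt_self_iff_false, and_false, or_self, if_false] at hik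
        by_cases hab : a = i ∧ b = k
        · obtain ⟨rfl, rfl⟩ := hab
          simp [execs, Instr.det, h10, h11, hik, h12, h3, hc.zero, hu]
        · have h4 : (a < i ∨ a = i ∧ b < k + 1) ↔ (a < i ∨ a = i ∧ b < k) := by omega
          simp only [h4]
          simp [execs, Instr.det, h10, h11, hab, h1 a ha b hb]
      · simp [execs, Instr.det, h11, hc.one]
      · simp [execs, Instr.det, h12]
    · simpa using hυ
    · rintro υ ⟨h, -, h'⟩
      exact h
  refine (Term.seq (P := I 0 0) (k := 3) (Term.block (by simp [Instr.IsDet]) ?_) fun υ hυ =>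
    Term.loop (N := d) (k := 14 * d + 13) (fun i => I i 0) ?_ ?_ hυ).mono (by nlinarith) ?_
  · refine ⟨(Frame.refl σ).execs (by simp [Instr.Scratch]), ?_, ?_, ?_, ?_⟩ <;>
      simp [execs, Instr.det]
  · rintro i υ hi ⟨f, h1, h2, h10, -⟩
    simp [Test.Holds, h10, (hσ.frame f).dim]
  · intro i τ hi hτ
    refine (Term.seq (hinner i τ hi hτ) fun υ hυ => Term.block (by simp [Instr.IsDet]) ?_).mono
      le_rfl fun _ => id
    obtain ⟨f, h3, h2, h10, h1⟩ := hυ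
    have hc := hσ.frame f
    refine ⟨f.execs (by simp [Instr.Scratch]), ?_, ?_, ?_, ?_⟩
    · simpa [execs, Instr.det]
    · simpa [execs, Instr.det]
    · simp [execs, Instr.det, h10, hc.one]
    · intro a ha b hb
      have h4 : (a < i + 1 ∨ a = i + 1 ∧ b < 0) ↔ (a < i ∨ a = i ∧ b < d) := by omega
      simp only [h4]
      simpa [execs, Instr.det] using h1 a ha b hb
  · rintro υ ⟨f, h3, h2, -, h1⟩
    refine ⟨f, h3, h2, ?_⟩
    ext a b
    simp [matOf, h1 a a.2 b b.2, hu, vecOf, vecMulVec_apply]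
    ring

end RealRAM

namespace RealRAM

open Matrix VolumeSampling

variable {d n : ℕ}

/-! ## Sets represented by arrays -/

/-- The first `S.card` entries of `a` list the elements of `S`. -/
def Lists (a : ℕ → ℕ) (S : Finset (Fin n)) : Prop :=
  (Finset.range S.card).image a = S.map Fin.valEmbedding

/-- A map from `S.card` positions onto a set of `S.card` elements is injective, so the listing has
no repetitions. -/
theorem Lists.injOn {a : ℕ → ℕ} {S : Finset (Fin n)} (h : Lists a S) :
    Set.InjOn a (Finset.range S.card) := by
  rw [← Finset.card_image_iff, h, Finset.card_map, Finset.card_range]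

theorem Lists.exists_mem {a : ℕ → ℕ} {S : Finset (Fin n)} (h : Lists a S) {p : ℕ}
    (hp : p < S.card) : ∃ i ∈ S, a p = (i : ℕ) := by
  have : a p ∈ S.map Fin.valEmbedding := by
    rw [← h]; exact Finset.mem_image_of_mem _ (Finset.mem_range.2 hp)
  obtain ⟨i, hi, e⟩ := Finset.mem_map.1 this
  exact ⟨i, hi, e.symm⟩

theorem Lists.exists_index {a : ℕ → ℕ} {S : Finset (Fin n)} (h : Lists a S) {i : Fin n}
    (hi : i ∈ S) : ∃ p < S.card, a p = (i : ℕ) := by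
  have : (i : ℕ) ∈ (Finset.range S.card).image a := by
    rw [h]; exact Finset.mem_map_of_mem Fin.valEmbedding hi
  simpa using this

theorem Lists.sum_eq {a : ℕ → ℕ} {S : Finset (Fin n)} (h : Lists a S) (f : ℕ → ℝ) :
    ∑ p ∈ Finset.range S.card, f (a p) = ∑ i ∈ S, f i := by
  rw [← Finset.sum_image h.injOn, h, Finset.sum_map]
  rfl

/-- Removal in constant time: the last listed element overwrites position `p`, and the stale last
entry falls outside the shortened range. -/
theorem Lists.erase {a a' : ℕ → ℕ} {S : Finset (Fin n)} (h : Lists a S) {p : ℕ}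
    (hp : p < S.card) {i : Fin n} (hi : a p = i)
    (ha' : ∀ l, a' l = if l = p then a (S.card - 1) else a l) : Lists a' (S.erase i) := by
  have hne : ∀ l < S.card, l ≠ p → a l ≠ i := fun l hl hlp e =>
    hlp (h.injOn (by simpa using hl) (by simpa using hp) (e.trans hi.symm))
  have hiS : i ∈ S := by
    obtain ⟨j, hj, e⟩ := h.exists_mem hp
    rwa [show i = j from Fin.ext (hi.symm.trans e)]
  rw [Lists, Finset.card_erase_of_mem hiS]
  ext x
  simp only [Finset.mem_image, Finset.mem_range, Finset.mem_map, Finset.mem_erase,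
    Fin.valEmbedding_apply]
  constructor
  · rintro ⟨l, hl, rfl⟩
    have key : ∀ q < S.card, q ≠ p → ∃ j, (j ≠ i ∧ j ∈ S) ∧ (j : ℕ) = a q := by
      intro q hq hqp
      obtain ⟨j, hj, e⟩ := h.exists_mem hq
      exact ⟨j, ⟨fun hji => hne q hq hqp (by rw [e, hji]), hj⟩, e.symm⟩
    rw [ha']
    split_ifs with hlp
    · exact key _ (by omega) (by omega)
    · exact key _ (by omega) hlp
  · rintro ⟨j, ⟨hji, hj⟩, rfl⟩
    obtain ⟨l, hl, e⟩ := h.exists_index hj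
    have hlp : l ≠ p := by
      rintro rfl
      exact hji (Fin.ext (e.symm.trans hi))
    by_cases hlast : l = S.card - 1
    · exact ⟨p, by omega, by rw [ha', if_pos rfl, ← hlast, e]⟩
    · exact ⟨l, by omega, by rw [ha', if_neg hlp, e]⟩

/-! ## The sampler -/

/-- The data kept by the sampler: integer registers below `7`, real registers below `2`, the integer
arrays, and the real arrays `0` and `1`. -/
structure SameData (σ τ : State) : Prop where
  narr : τ.narr = σ.narr
  nreg : ∀ a < 7, τ.nreg a = σ.nreg a
  rreg : ∀ a < 2, τ.rreg a = σ.rreg a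
  rarr : ∀ A < 2, ∀ i j, τ.rarr A i j = σ.rarr A i j

theorem SameData.refl (σ : State) : SameData σ σ := ⟨rfl, by simp, by simp, by simp⟩

theorem SameData.trans {σ τ υ : State} (h : SameData σ τ) (h' : SameData τ υ) : SameData σ υ :=
  ⟨h'.narr.trans h.narr, fun a ha => (h'.nreg a ha).trans (h.nreg a ha),
    fun a ha => (h'.rreg a ha).trans (h.rreg a ha),
    fun A hA i j => (h'.rarr A hA i j).trans (h.rarr A hA i j)⟩

theorem Frame.sameData {σ τ : State} (h : Frame σ τ) (h1 : ∀ i j, τ.rarr 1 i j = σ.rarr 1 i j) :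
    SameData σ τ :=
  ⟨h.narr, fun a ha => h.nreg a (by omega), fun a ha => h.rreg a (by omega) (by omega),
    fun A hA i j => by
      obtain rfl | rfl : A = 0 ∨ A = 1 := by omega
      · exact h.rarr 0 (by norm_num) (by norm_num) i j
      · exact h1 i j⟩

/-- Deterministic instructions that respect `SameData`. -/
def Instr.Safe : Instr → Prop
  | .nconst a _ | .ncopy a _ | .nadd a _ _ | .nsub a _ _ | .nload a _ _ => 7 ≤ a
  | .rconst a _ | .rcopy a _ | .radd a _ _ | .rsub a _ _ | .rmul a _ _ | .rdiv a _ _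
  | .rload a _ _ _ => 2 ≤ a
  | .rstore A _ _ _ => 2 ≤ A
  | .nstore _ _ _ | .unif _ _ | .flip _ _ => False

theorem SameData.setN (σ : State) {a : ℕ} (ha : 7 ≤ a) (v : ℕ) : SameData σ (σ.setN a v) :=
  ⟨rfl, fun b hb => by simp [show b ≠ a by omega], fun _ _ => rfl, fun _ _ _ _ => rfl⟩

theorem SameData.setR (σ : State) {a : ℕ} (ha : 2 ≤ a) (v : ℝ) : SameData σ (σ.setR a v) :=
  ⟨rfl, fun _ _ => rfl, fun b hb => by simp [show b ≠ a by omega], fun _ _ _ _ => rfl⟩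

theorem SameData.setRArr (σ : State) {A : ℕ} (hA : 2 ≤ A) (i j : ℕ) (v : ℝ) :
    SameData σ (σ.setRArr A i j v) :=
  ⟨rfl, fun _ _ => rfl, fun _ _ => rfl, fun B hB k l => by simp [show B ≠ A by omega]⟩

theorem Instr.Safe.sameData {o : Instr} (h : o.Safe) (σ : State) : SameData σ (o.det σ) := by
  cases o <;>
    first
    | exact SameData.setN σ h _
    | exact SameData.setR σ h _
    | exact SameData.setRArr σ h _ _ _
    | exact h.elim

theorem SameData.execs {l : List Instr} (hl : ∀ o ∈ l, o.Safe) {σ τ : State} (h : SameData σ τ) :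
    SameData σ (execs l τ) := by
  induction l generalizing τ with
  | nil => exact h
  | cons o l ih =>
    exact ih (fun o ho => hl o (by simp [ho])) (h.trans ((hl o (by simp)).sameData τ))

/-- The memory represents the current set `S`: real array `1` holds the inverse of
`X_S X_Sᵀ + lam I`, integer array `0` lists `S`, and integer register `3` holds its size. -/
structure Inv (X : Matrix (Fin d) (Fin n) ℝ) (lam : ℝ) (s : ℕ) (S : Finset (Fin n)) (σ : State) :
    Prop where
  consts : Consts d σ
  size : σ.nreg 2 = s
  card : σ.nreg 3 = S.card
  thr : σ.nreg 6 = max s (2 * d)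
  rone : σ.rreg 1 = 1
  lists : Lists (σ.narr 0) S
  cols : ∀ i : Fin n, colOf d σ i = X.col i
  mat : matOf d σ = (regGram X lam S)⁻¹

variable {X : Matrix (Fin d) (Fin n) ℝ} {lam : ℝ} {s : ℕ} {S : Finset (Fin n)}

theorem Inv.sameData {σ τ : State} (h : Inv X lam s S σ) (h' : SameData σ τ) :
    Inv X lam s S τ where
  consts := ⟨(h'.nreg 1 (by norm_num)).trans h.consts.dim,
    (h'.nreg 4 (by norm_num)).trans h.consts.one, (h'.nreg 5 (by norm_num)).trans h.consts.zero⟩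
  size := (h'.nreg 2 (by norm_num)).trans h.size
  card := (h'.nreg 3 (by norm_num)).trans h.card
  thr := (h'.nreg 6 (by norm_num)).trans h.thr
  rone := (h'.rreg 1 (by norm_num)).trans h.rone
  lists := by rw [h'.narr]; exact h.lists
  cols i := (funext fun a => h'.rarr 0 (by norm_num) a i : colOf d τ i = colOf d σ i).trans
    (h.cols i)
  mat := by
    rw [← h.mat]
    ext a b
    exact h'.rarr 1 (by norm_num) a b

theorem Inv.output {σ : State} (h : Inv X lam s S σ) (hs : S.card = s) : output n s σ = S := by
  ext j
  have hl := h.lists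
  rw [Lists, hs] at hl
  simp only [RealRAM.output, hl, Finset.mem_filter_univ, Finset.mem_map, Fin.valEmbedding_apply,
    Fin.val_inj, exists_eq_right]

theorem Inv.term_quadProg {σ : State} (h : Inv X lam s S σ) (hd : 0 < d) {i : Fin n}
    (h8 : σ.nreg 8 = i) :
    Term quadProg σ (60 * d ^ 2) fun τ => Frame σ τ ∧ SameData σ τ ∧ Inv X lam s S τ ∧
      vecOf d τ = (regGram X lam S)⁻¹ *ᵥ X.col i ∧ τ.rreg 2 = 1 - lev X lam S i := by
  refine (RealRAM.term_quadProg h.consts hd).mono le_rfl fun τ ⟨f, h1, h2, h3⟩ => ?_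
  refine ⟨f, f.sameData h1, h.sameData (f.sameData h1), ?_, ?_⟩
  · rw [h2, h8, h.cols, h.mat]
  · rw [h3, h8, h.cols, h.mat, lev]
    ring

/-- Remove the element at the position held by integer register `7`, after `quadProg` has been
run for the corresponding column. -/
def removeProg : Prog :=
  .seq (block [.rsub 3 1 2, .rconst 10 (-1), .rdiv 3 10 3])
    (.seq updateProg (block [.nsub 3 3 4, .nload 12 0 3, .nstore 0 7 12]))

theorem Inv.term_removeProg {σ : State} (h : Inv X lam s S σ) (hd : 0 < d)
    (hS : (regGram X lam S).PosDef) {i : Fin n} (hi : i ∈ S) {p : ℕ} (hp : p < S.card)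
    (h7 : σ.nreg 7 = p) (hpi : σ.narr 0 p = i)
    (hv : vecOf d σ = (regGram X lam S)⁻¹ *ᵥ X.col i) (h2 : σ.rreg 2 = 1 - lev X lam S i)
    (hlev : lev X lam S i ≠ 0) :
    Term removeProg σ (80 * d ^ 2) fun τ => Inv X lam s (S.erase i) τ ∧ vecOf d τ = vecOf d σ ∧
      τ.rreg 3 = -1 / lev X lam S i ∧ ∀ k l, τ.rarr 4 k l = σ.rarr 4 k l := by
  have hd2 : 1 ≤ d ^ 2 := Nat.one_le_pow _ _ hd
  set σ₁ := execs [.rsub 3 1 2, .rconst 10 (-1), .rdiv 3 10 3] σ with hσ₁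
  have hsame : SameData σ σ₁ := (SameData.refl σ).execs (by simp [Instr.Safe])
  have hI := h.sameData hsame
  have e3 : σ₁.rreg 3 = -1 / lev X lam S i := by
    simp [hσ₁, execs, Instr.det, h.rone, h2]
  have ev : vecOf d σ₁ = vecOf d σ := rfl
  refine (Term.block_seq (k := 60 * d ^ 2 + 7 + 1) (by simp [Instr.IsDet])
    (Term.seq (term_updateProg hI.consts hd) fun υ hυ =>
      Term.block (by simp [Instr.IsDet]) ?_)).mono (by simp; omega) fun _ => id
  obtain ⟨f, h3, -, hm⟩ := hυ
  rw [← hσ₁] at f hm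
  have n7 : υ.nreg 7 = p := (f.nreg 7 (by norm_num)).trans h7
  have n3 : υ.nreg 3 = S.card := (f.nreg 3 (by norm_num)).trans hI.card
  have n4 : υ.nreg 4 = 1 := (f.nreg 4 (by norm_num)).trans hI.consts.one
  have narr : υ.narr = σ.narr := f.narr.trans hsame.narr
  refine ⟨⟨⟨?_, ?_, ?_⟩, ?_, ?_, ?_, ?_, ?_, ?_, ?_⟩, ?_, ?_, ?_⟩
  · simp [execs, Instr.det, f.nreg 1, hI.consts.dim]
  · simp [execs, Instr.det, f.nreg 4, hI.consts.one]
  · simp [execs, Instr.det, f.nreg 5, hI.consts.zero]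
  · simp [execs, Instr.det, f.nreg 2, hI.size]
  · simp [execs, Instr.det, n3, n4, Finset.card_erase_of_mem hi]
  · simp [execs, Instr.det, f.nreg 6, hI.thr]
  · simp [execs, Instr.det, f.rreg 1, hI.rone]
  · refine h.lists.erase hp hpi fun l => ?_
    simp [execs, Instr.det, n7, n3, n4, narr]
  · intro j
    exact (f.colOf d j).trans (hI.cols j)
  · refine Eq.trans (hm.trans ?_) (inv_erase hS hi hlev).symm
    rw [hI.mat, e3, ev, hv]
  · rw [← ev]
    exact funext fun a => h3 a 0
  · simp [execs, Instr.det, f.rreg 3, e3]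
  · exact fun k l => f.rarr 4 (by norm_num) (by norm_num) k l

/-! ### Removal by rejection sampling -/

/-- Propose a uniform element of the current set and remove it with the correct probability. -/
def trialProg : Prog :=
  .seq (.op (.unif 7 3))
    (.seq (.seq (block [.nload 8 0 7]) (.seq quadProg (block [.rsub 10 1 2])))
      (.seq (.op (.flip 12 10)) (.cond (.nlt 5 12) removeProg .skip)))

variable {Q : State → Prop}

/-- One-step analysis of a proposal: `x` bounds the continuation after a rejection, `y i` after the
removal of `i`. The bound `y i` is required only for positive weights, since no other removal
occurs. -/
theorem Inv.le_val_trialProg {σ : State} (h : Inv X lam s S σ) (hd : 0 < d) (hl : 0 ≤ lam)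
    (hS : (regGram X lam S).PosDef) (hne : S.Nonempty) {K : List Prog} {B : ℕ}
    {x : ℝ} {y : Fin n → ℝ} (hx : ∀ τ, Inv X lam s S τ → x ≤ val Q B K τ)
    (hy : ∀ i ∈ S, 0 < lev X lam S i → ∀ τ, Inv X lam s (S.erase i) τ → y i ≤ val Q B K τ) :
    ∑ i ∈ S, (1 / S.card : ℝ) * (lev X lam S i * y i + (1 - lev X lam S i) * x) ≤
      val Q (B + 160 * d ^ 2) (trialProg :: K) σ := by
  have hd2 : 1 ≤ d ^ 2 := Nat.one_le_pow _ _ hd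
  -- The array stores natural numbers, so the summand is extended from `Fin n` to `ℕ` before the sum
  -- over positions is turned into a sum over `S`.
  let g : ℕ → ℝ := fun k => if hk : k < n then
    (1 / S.card : ℝ) * (lev X lam S ⟨k, hk⟩ * y ⟨k, hk⟩ + (1 - lev X lam S ⟨k, hk⟩) * x) else 0
  have hg : ∀ i : Fin n,
      g i = (1 / S.card : ℝ) * (lev X lam S i * y i + (1 - lev X lam S i) * x) := by
    intro i; simp [g]
  refine le_trans ?_ (val_mono (show B + 80 * d ^ 2 + 1 + 1 + 1 + (60 * d ^ 2 + 8) + 1 + 1 + 1 ≤ _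
    by omega) _ _)
  rw [trialProg, val_seq, val_unif h.card (Finset.card_pos.2 hne), ← Finset.sum_congr rfl
    (fun i _ => hg i), ← h.lists.sum_eq]
  refine Finset.sum_le_sum fun p hp => ?_
  rw [Finset.mem_range] at hp
  obtain ⟨i, hi, hpi⟩ := h.lists.exists_mem hp
  rw [hpi, hg]
  refine mul_le_mul_of_nonneg_left ?_ (by positivity)
  rw [val_seq]
  set σ₁ := execs [.nload 8 0 7] (σ.setN 7 p) with hσ₁
  have hI₁ : Inv X lam s S σ₁ := h.sameData
    ((SameData.setN σ (by norm_num) p).execs (by simp [Instr.Safe]))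
  have h8 : σ₁.nreg 8 = i := by simp [hσ₁, execs, Instr.det, hpi]
  have h7 : σ₁.nreg 7 = p := by simp [hσ₁, execs, Instr.det]
  have hp₁ : σ₁.narr 0 p = i := hpi
  refine le_val_of_term (k := 60 * d ^ 2 + 8) (t := B + 80 * d ^ 2 + 1 + 1 + 1)
    (P := fun τ => Inv X lam s S τ ∧
      vecOf d τ = (regGram X lam S)⁻¹ *ᵥ X.col i ∧ τ.rreg 2 = 1 - lev X lam S i ∧
      τ.rreg 10 = lev X lam S i ∧ τ.nreg 7 = p ∧ τ.narr 0 p = i) ?_ ?_ (by omega)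
  · refine (Term.block_seq (k := 60 * d ^ 2 + 3 + 1) (by simp [Instr.IsDet])
      (Term.seq (hI₁.term_quadProg hd h8) fun υ hυ =>
        Term.block (by simp [Instr.IsDet]) ?_)).mono (by simp; omega) fun _ => id
    obtain ⟨f, -, hI, hv, h2⟩ := hυ
    refine ⟨hI.sameData ((SameData.refl υ).execs (by simp [Instr.Safe])), hv, ?_, ?_, ?_, ?_⟩
    · simp [execs, Instr.det, h2]
    · simp [execs, Instr.det, h2, hI.rone]
    · simp [execs, Instr.det, f.nreg 7, h7]
    · simp [execs, Instr.det, f.narr, hp₁]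
  · rintro τ ⟨hI, hv, h2, h10, h7, hpi⟩
    have hn := lev_nonneg hl hS hi
    rw [val_seq, val_flip h10 hn (lev_le_one hS),
      val_cond_true (by simp [Test.Holds, hI.consts.zero]),
      val_cond_false (by simp [Test.Holds, hI.consts.zero])]
    refine add_le_add ?_ (mul_le_mul_of_nonneg_left ?_ (sub_nonneg.2 (lev_le_one hS)))
    -- At weight zero the acceptance branch has probability zero; its code, which would divide by
    -- zero, need not be analysed.
    · rcases hn.eq_or_lt with h0 | h0
      · simp [← h0]
      · refine mul_le_mul_of_nonneg_left ?_ hn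
        exact le_val_of_term (Inv.term_removeProg
          (hI.sameData (SameData.setN τ (a := 12) (by norm_num) 1)) hd hS hi hp (by simpa using h7)
          hpi hv h2 h0.ne') (fun υ hυ => hy i hi h0 υ hυ.1) le_rfl
    · exact le_val_of_term (t := B) (Term.skip rfl) (fun υ hυ => hx υ
        (hυ ▸ hI.sameData (SameData.setN τ (by norm_num) 0))) (by omega)

/-- Rejection sampling until at most `max s (2 * d)` elements are left. -/
def rejectProg : Prog := .loop (.nlt 6 3) trialProg

/-- The deficit `2^|S| (3/4)^r` bounds the probability lost when only `r` trials are budgeted. A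
removal halves it and a rejection leaves it alone, so with acceptance probability `q ≥ 1/2` a trial
multiplies it by `1 - q/2 ≤ 3/4` on average. No deficit remains once the threshold is reached. -/
theorem le_val_rejectProg (hd : 0 < d) (hl : 0 ≤ lam) {R : Finset (Fin n) → Prop} {K : List Prog}
    {B : ℕ} (hK : ∀ S σ, (regGram X lam S).PosDef → Inv X lam s S σ → s ≤ S.card →
      S.card ≤ max s (2 * d) → condProb X lam R (S.card - s) S ≤ val Q B K σ) (r : ℕ) :
    ∀ S σ, (regGram X lam S).PosDef → Inv X lam s S σ → s ≤ S.card →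
      condProb X lam R (S.card - s) S -
        (if S.card ≤ max s (2 * d) then 0 else 2 ^ S.card * (3 / 4 : ℝ) ^ r) ≤
      val Q (B + 1 + r * (200 * d ^ 2)) (rejectProg :: K) σ := by
  have hd2 : 1 ≤ d ^ 2 := Nat.one_le_pow _ _ hd
  have exit : ∀ (r : ℕ) S σ, (regGram X lam S).PosDef → Inv X lam s S σ → s ≤ S.card →
      S.card ≤ max s (2 * d) → condProb X lam R (S.card - s) S ≤
        val Q (B + 1 + r * (200 * d ^ 2)) (rejectProg :: K) σ := by
    intro r S σ hS h hs hle
    refine le_trans ?_ (val_mono (show B + 1 ≤ _ by omega) _ _)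
    rw [rejectProg, val_loop_false]
    · exact hK S σ hS h hs hle
    · simp only [Test.Holds, h.thr, h.card]
      omega
  induction r with
  | zero =>
    intro S σ hS h hs
    split_ifs with hle
    · simpa using exit 0 S σ hS h hs hle
    · have h1 := (condProb_nonneg_le_one hl R (S.card - s) hS).2
      -- With no trials budgeted the deficit is at least one and the claim is trivial.
      have h2 : (1 : ℝ) ≤ 2 ^ S.card := one_le_pow₀ (by norm_num)
      have h3 : 0 ≤ val Q (B + 1 + 0 * (200 * d ^ 2)) (rejectProg :: K) σ := val_nonneg _ _ _
      simp only [pow_zero, mul_one]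
      linarith
  | succ r ih =>
    intro S σ hS h hs
    split_ifs with hle
    · simpa using exit (r + 1) S σ hS h hs hle
    · push Not at hle
      have hne : S.Nonempty := Finset.card_pos.1 (by omega)
      have hdS : (2 * d : ℝ) ≤ S.card := by
        have : 2 * d ≤ S.card := by omega
        exact_mod_cast this
      have hd1 : (1 : ℝ) ≤ d := by exact_mod_cast hd
      set ε : ℝ := 2 ^ S.card * (3 / 4 : ℝ) ^ r with hε
      have hε0 : 0 ≤ ε := by positivity
      have key := h.le_val_trialProg (Q := Q) hd hl hS hne
        (K := rejectProg :: K) (B := B + 1 + r * (200 * d ^ 2))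
        (x := condProb X lam R (S.card - s) S - ε)
        (y := fun i => condProb X lam R (S.card - s - 1) (S.erase i) - ε / 2) ?_ ?_
      · refine le_trans ?_ (key.trans ?_)
        · set H := ∑ i ∈ S, lev X lam S i with hH
          have hHge : (S.card - d : ℝ) ≤ H := card_sub_le_sum_lev hl hS
          have hHpos : 0 < H := by linarith
          obtain ⟨k, hk⟩ : ∃ k, S.card - s = k + 1 := ⟨S.card - s - 1, by omega⟩
          have hG := sum_lev_mul_condProb R k hS hHpos
          rw [hk, Nat.add_sub_cancel]
          set G := condProb X lam R (k + 1) S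
          have hm : (0 : ℝ) < S.card := by linarith
          -- The target value `G` reproduces itself: accepted proposals contribute `(H/|S|) G` by
          -- `sum_lev_mul_condProb`, rejected ones `(1 - H/|S|) G`. Only the deficit changes.
          have e : ∑ i ∈ S, (1 / S.card : ℝ) * (lev X lam S i *
              (condProb X lam R k (S.erase i) - ε / 2) + (1 - lev X lam S i) * (G - ε)) =
              G - ε + H / S.card * (ε / 2) := by
            have : ∀ i ∈ S, (1 / S.card : ℝ) * (lev X lam S i *
              (condProb X lam R k (S.erase i) - ε / 2) + (1 - lev X lam S i) * (G - ε)) =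
              (1 / S.card : ℝ) * (lev X lam S i * condProb X lam R k (S.erase i)) +
              (1 / S.card : ℝ) * (ε / 2 - G) * lev X lam S i + (1 / S.card : ℝ) * (G - ε) := by
              intro i _; ring
            rw [Finset.sum_congr rfl this, Finset.sum_add_distrib, Finset.sum_add_distrib,
              ← Finset.mul_sum, ← Finset.mul_sum, hG, ← hH, Finset.sum_const, nsmul_eq_mul]
            field_simp
            ring
          rw [e]
          -- This is where the threshold `2d` enters: `H ≥ |S| - d ≥ |S|/2`.
          have hhalf : 1 / 2 ≤ H / S.card := by
            rw [div_le_div_iff₀ (by norm_num) hm]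
            linarith
          have : 2 ^ S.card * (3 / 4 : ℝ) ^ (r + 1) = 3 / 4 * ε := by rw [hε, pow_succ]; ring
          rw [this]
          nlinarith
        · refine le_trans ?_ (val_mono (show B + 1 + r * (200 * d ^ 2) + 160 * d ^ 2 + 1 ≤ _ by
            rw [add_mul]; omega) _ _)
          rw [rejectProg, val_loop_true]
          simp only [Test.Holds, h.thr, h.card]
          omega
      · intro τ hτ
        have := ih S τ hS hτ hs
        rwa [if_neg (by omega)] at this
      · intro i hi hpos τ hτ
        have hc := Finset.card_erase_of_mem hi
        have := ih (S.erase i) τ (posDef_erase hl hS hi hpos) hτ (by omega)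
        rw [show (S.erase i).card - s = S.card - s - 1 by omega] at this
        refine le_trans ?_ this
        have h2 : (2 : ℝ) ^ (S.erase i).card * (3 / 4 : ℝ) ^ r = ε / 2 := by
          rw [hε, hc, ← Nat.succ_pred_eq_of_pos (Finset.card_pos.2 hne), pow_succ]
          simp
          ring
        split_ifs
        · linarith
        · rw [h2]

end RealRAM

namespace RealRAM

open Matrix VolumeSampling

variable {d n : ℕ} {X : Matrix (Fin d) (Fin n) ℝ} {lam : ℝ} {s : ℕ} {S : Finset (Fin n)}
  {Q : State → Prop}

/-! ### Removal by exact sampling -/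

/-- Real array `4` holds the removal weights of the elements of `S`. -/
def Scores (X : Matrix (Fin d) (Fin n) ℝ) (lam : ℝ) (S : Finset (Fin n)) (σ : State) : Prop :=
  ∀ i ∈ S, σ.rarr 4 i 0 = lev X lam S i

/-- Compute the removal weights of the elements of the current set. -/
def scoreProg : Prog :=
  .seq (block [.nconst 9 0])
    (.loop (.nlt 9 3)
      (.seq (block [.nload 8 0 9])
        (.seq quadProg (block [.rsub 10 1 2, .rstore 4 8 5 10, .nadd 9 9 4]))))

theorem Inv.term_scoreProg {σ : State} (h : Inv X lam s S σ) (hd : 0 < d) :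
    Term scoreProg σ (S.card * (80 * d ^ 2) + 5) fun τ => Inv X lam s S τ ∧ Scores X lam S τ := by
  have hd2 : 1 ≤ d ^ 2 := Nat.one_le_pow _ _ hd
  let I : ℕ → State → Prop := fun k τ => SameData σ τ ∧ τ.nreg 9 = k ∧
    ∀ l < k, ∀ i : Fin n, σ.narr 0 l = i → τ.rarr 4 i 0 = lev X lam S i
  refine (Term.block_seq (by simp [Instr.IsDet]) (Term.loop (N := S.card) (k := 60 * d ^ 2 + 12) I
    ?_ ?_ ?_)).mono ?_ ?_
  · rintro k τ hk ⟨hs, h9, -⟩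
    simp [Test.Holds, h9, (h.sameData hs).card]
  · rintro k τ hk ⟨hs, h9, h4⟩
    obtain ⟨i, hi, hki⟩ := h.lists.exists_mem hk
    set τ₁ := execs [.nload 8 0 9] τ with hτ₁
    have hs₁ : SameData σ τ₁ := hs.execs (by simp [Instr.Safe])
    have hI₁ := h.sameData hs₁
    have h8 : τ₁.nreg 8 = i := by simp [hτ₁, execs, Instr.det, h9, hs.narr, hki]
    have h9' : τ₁.nreg 9 = k := by simp [hτ₁, execs, Instr.det, h9]
    have h4' : τ₁.rarr = τ.rarr := rfl
    refine (Term.block_seq (by simp [Instr.IsDet]) (Term.seq (hI₁.term_quadProg hd h8)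
      fun υ hυ => Term.block (by simp [Instr.IsDet]) ?_)).mono (by simp; omega) fun _ => id
    obtain ⟨f, hs₂, hI, -, h2⟩ := hυ
    have hc : υ.nreg 8 = i := (f.nreg 8 (by norm_num)).trans h8
    have hn : υ.nreg 9 = k := (f.nreg 9 (by norm_num)).trans h9'
    refine ⟨(hs₁.trans hs₂).execs (by simp [Instr.Safe]), ?_, ?_⟩
    · simp [execs, Instr.det, hn, hI.consts.one]
    · intro l hl j hj
      by_cases hji : j = i
      · simp [execs, Instr.det, hc, hji, h2, hI.consts.zero, hI.rone]
      · have hji' : (j : ℕ) ≠ i := fun e => hji (Fin.ext e)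
        have hlk : l < k := by
          rcases Nat.lt_succ_iff_lt_or_eq.1 hl with h | rfl
          · exact h
          · exact absurd (Fin.ext (hj.symm.trans hki)) hji
        simp [execs, Instr.det, hc, hji', f.rarr 4, h4', h4 l hlk j hj]
  · exact ⟨(SameData.refl σ).execs (by simp [Instr.Safe]), by simp [execs, Instr.det], by simp⟩
  · simp only [List.length_cons, List.length_nil]
    nlinarith
  · rintro τ ⟨hs, -, h4⟩
    refine ⟨h.sameData hs, fun i hi => ?_⟩
    obtain ⟨p, hp, e⟩ := h.lists.exists_index hi
    exact h4 p hp i e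

/-- Set integer register `7` to a random position of the current set, drawn with probability
proportional to the removal weights. -/
def drawProg : Prog :=
  .seq (block [.nconst 9 0, .nconst 7 0, .rconst 4 0])
    (.loop (.nlt 9 3)
      (.seq (block [.nload 8 0 9, .rload 10 4 8 5, .radd 4 4 10, .rdiv 10 10 4])
        (.seq (.op (.flip 12 10))
          (.seq (.cond (.nlt 5 12) (block [.ncopy 7 9]) .skip) (block [.nadd 9 9 4])))))

/-- Weighted reservoir sampling. When position `k` is scanned it replaces the held position `p` with
probability `g k` over the running total. Thus, after `k` positions, `p` survives to the end with
probability `(∑ l < k, g l) / ∑ g`, and each later `l` is chosen with probability `g l / ∑ g`. -/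
theorem le_val_drawLoop {σ : State} (hone : σ.nreg 4 = 1) (hzero : σ.nreg 5 = 0) {m : ℕ}
    (hm : σ.nreg 3 = m) {g : ℕ → ℝ} (hg : ∀ l < m, σ.rarr 4 (σ.narr 0 l) 0 = g l)
    (hg0 : ∀ l < m, 0 ≤ g l) (hpos : 0 < ∑ l ∈ Finset.range m, g l) {K : List Prog} {B : ℕ}
    {F : ℕ → ℝ} (hF : ∀ p < m, ∀ τ, SameData σ τ → (∀ i j, τ.rarr 4 i j = σ.rarr 4 i j) →
      τ.nreg 7 = p → F p ≤ val Q B K τ) (r : ℕ) :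
    ∀ k p τ, k + r = m → p < m → SameData σ τ → (∀ i j, τ.rarr 4 i j = σ.rarr 4 i j) →
      τ.nreg 9 = k → τ.nreg 7 = p → τ.rreg 4 = ∑ l ∈ Finset.range k, g l →
      ((∑ l ∈ Finset.range k, g l) * F p + ∑ l ∈ Finset.Ico k m, g l * F l) /
          ∑ l ∈ Finset.range m, g l ≤
        val Q (B + 1 + r * 30)
          (.loop (.nlt 9 3)
            (.seq (block [.nload 8 0 9, .rload 10 4 8 5, .radd 4 4 10, .rdiv 10 10 4])
              (.seq (.op (.flip 12 10)) (.seq (.cond (.nlt 5 12) (block [.ncopy 7 9]) .skip)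
                (block [.nadd 9 9 4])))) :: K) τ := by
  induction r with
  | zero =>
    intro k p τ hk hp hs h4 h9 h7 hacc
    obtain rfl : k = m := by omega
    rw [Finset.Ico_self, Finset.sum_empty, add_zero, mul_div_cancel_left₀ _ hpos.ne', zero_mul,
      add_zero, val_loop_false]
    · exact hF p hp τ hs h4 h7
    · simp [Test.Holds, h9, hs.nreg 3, hm]
  | succ r ih =>
    intro k p τ hk hp hs h4 h9 h7 hacc
    have hkm : k < m := by omega
    set H := ∑ l ∈ Finset.range m, g l
    set a := ∑ l ∈ Finset.range k, g l with ha
    have ha0 : 0 ≤ a := Finset.sum_nonneg fun l hl => hg0 l (by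
      have := Finset.mem_range.1 hl; omega)
    have hgk := hg0 k hkm
    set τ₁ := execs [.nload 8 0 9, .rload 10 4 8 5, .radd 4 4 10, .rdiv 10 10 4] τ with hτ₁
    have hs₁ : SameData σ τ₁ := hs.execs (by simp [Instr.Safe])
    have e4 : τ₁.rreg 4 = a + g k := by
      simp [hτ₁, execs, Instr.det, hacc, h9, hs.narr, hs.nreg 5, hzero, h4, hg k hkm]
    have e10 : τ₁.rreg 10 = g k / (a + g k) := by
      simp [hτ₁, execs, Instr.det, hacc, h9, hs.narr, hs.nreg 5, hzero, h4, hg k hkm]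
    have e9 : τ₁.nreg 9 = k := by simp [hτ₁, execs, Instr.det, h9]
    have e7 : τ₁.nreg 7 = p := by simp [hτ₁, execs, Instr.det, h7]
    have er : τ₁.rarr = τ.rarr := rfl
    have hq0 : 0 ≤ g k / (a + g k) := by positivity
    have hq1 : g k / (a + g k) ≤ 1 := div_le_one_of_le₀ (by linarith) (by linarith)
    have tail : ∀ c : ℕ, Term (.seq (.cond (.nlt 5 12) (block [.ncopy 7 9]) .skip)
        (block [.nadd 9 9 4])) (τ₁.setN 12 c) 8 fun υ => SameData σ υ ∧
          (∀ i j, υ.rarr 4 i j = σ.rarr 4 i j) ∧ υ.nreg 9 = k + 1 ∧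
          υ.nreg 7 = (if 0 < c then k else p) ∧ υ.rreg 4 = a + g k := by
      intro c
      have hc : SameData σ (τ₁.setN 12 c) := hs₁.trans (SameData.setN _ (by norm_num) c)
      refine (Term.seq (P := fun υ => SameData σ υ ∧ (∀ i j, υ.rarr 4 i j = σ.rarr 4 i j) ∧
        υ.nreg 9 = k ∧ υ.nreg 7 = (if 0 < c then k else p) ∧ υ.rreg 4 = a + g k) (k := 4) (l := 3)
        ?_ ?_).mono le_rfl fun _ => id
      · split_ifs with hc0
        · refine Term.cond_true (by simp [Test.Holds, hs₁.nreg 5, hzero, hc0])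
            (Term.block (by simp [Instr.IsDet])
              ⟨hc.execs (by simp [Instr.Safe]), fun i j => h4 i j, ?_, ?_, ?_⟩)
          · simp [execs, Instr.det, e9]
          · simp [execs, Instr.det, e9]
          · simp [execs, Instr.det, e4]
        · refine (Term.cond_false (by simp [Test.Holds, hs₁.nreg 5, hzero]; omega)
            (Term.skip ⟨hc, fun i j => h4 i j, ?_, ?_, ?_⟩)).mono (by norm_num) fun _ => id
          · simp [e9]
          · simp [e7]
          · simp [e4]
      · rintro υ ⟨hυ, h4υ, h9υ, h7υ, haυ⟩
        refine Term.block (by simp [Instr.IsDet])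
          ⟨hυ.execs (by simp [Instr.Safe]), fun i j => h4υ i j, ?_, ?_, ?_⟩
        · simp [execs, Instr.det, h9υ, hυ.nreg 4, hone]
        · simp [execs, Instr.det, h7υ]
        · simp [execs, Instr.det, haυ]
    have next : ∀ c : ℕ, ((a + g k) * F (if 0 < c then k else p) +
        ∑ l ∈ Finset.Ico (k + 1) m, g l * F l) / H ≤ val Q (B + 1 + r * 30 + 8)
          (.seq (.cond (.nlt 5 12) (block [.ncopy 7 9]) .skip) (block [.nadd 9 9 4]) ::
            .loop (.nlt 9 3)
            (.seq (block [.nload 8 0 9, .rload 10 4 8 5, .radd 4 4 10, .rdiv 10 10 4])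
              (.seq (.op (.flip 12 10)) (.seq (.cond (.nlt 5 12) (block [.ncopy 7 9]) .skip)
                (block [.nadd 9 9 4])))) :: K) (τ₁.setN 12 c) := by
      intro c
      refine le_val_of_term (tail c) (fun υ hυ => ?_) le_rfl
      obtain ⟨hυ, h4υ, h9υ, h7υ, haυ⟩ := hυ
      have := ih (k + 1) (if 0 < c then k else p) υ (by omega) (by split_ifs <;> omega) hυ h4υ h9υ
        h7υ (by rw [haυ, Finset.sum_range_succ])
      rwa [Finset.sum_range_succ] at this
    refine le_trans ?_ (val_mono (show B + 1 + r * 30 + 8 + 1 + 1 + 9 + 1 + 1 ≤ _ by omega) _ _)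
    rw [val_loop_true (by simpa [Test.Holds, h9, hs.nreg 3, hm] using hkm), val_seq]
    refine le_val_of_term (P := fun υ => υ = τ₁) (k := 9) (Term.block (by simp [Instr.IsDet]) rfl)
      ?_ le_rfl
    rintro _ rfl
    rw [val_seq, val_flip e10 hq0 hq1]
    refine le_trans (le_of_eq ?_) (add_le_add (mul_le_mul_of_nonneg_left (next 1) hq0)
      (mul_le_mul_of_nonneg_left (next 0) (sub_nonneg.2 hq1)))
    simp only [zero_lt_one, if_true, lt_self_iff_false, if_false]
    rw [Finset.sum_eq_sum_Ico_succ_bot hkm]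
    -- If the running total is still zero, the coin has parameter `0 / 0 = 0`; the held position may
    -- then have weight zero, but its coefficient in the bound is zero too.
    rcases (add_nonneg ha0 hgk).eq_or_lt with h0 | h0
    · have h1 : a = 0 := by linarith
      have h2 : g k = 0 := by linarith
      simp [h1, h2]
    · field_simp
      ring

theorem le_val_drawProg {σ : State} (hone : σ.nreg 4 = 1) (hzero : σ.nreg 5 = 0) {m : ℕ}
    (hm : σ.nreg 3 = m) {g : ℕ → ℝ} (hg : ∀ l < m, σ.rarr 4 (σ.narr 0 l) 0 = g l)
    (hg0 : ∀ l < m, 0 ≤ g l) (hpos : 0 < ∑ l ∈ Finset.range m, g l) {K : List Prog} {B : ℕ}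
    {F : ℕ → ℝ} (hF : ∀ p < m, ∀ τ, SameData σ τ → (∀ i j, τ.rarr 4 i j = σ.rarr 4 i j) →
      τ.nreg 7 = p → F p ≤ val Q B K τ) :
    (∑ l ∈ Finset.range m, g l * F l) / ∑ l ∈ Finset.range m, g l ≤
      val Q (B + m * 30 + 9) (drawProg :: K) σ := by
  have hm0 : 0 < m := by
    rcases Nat.eq_zero_or_pos m with rfl | h
    · simp at hpos
    · exact h
  refine le_trans ?_ (val_mono (show B + 1 + m * 30 + 7 + 1 ≤ _ by omega) _ _)
  rw [drawProg, val_seq]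
  refine le_val_of_term (P := fun υ => υ = execs [.nconst 9 0, .nconst 7 0, .rconst 4 0] σ) (k := 7)
    (Term.block (by simp [Instr.IsDet]) rfl) ?_ le_rfl
  rintro _ rfl
  have := le_val_drawLoop hone hzero hm hg hg0 hpos hF m 0 0
    (execs [.nconst 9 0, .nconst 7 0, .rconst 4 0] σ) (by simp) hm0
    ((SameData.refl σ).execs (by simp [Instr.Safe])) (fun _ _ => rfl) (by simp [execs, Instr.det])
    (by simp [execs, Instr.det]) (by simp [execs, Instr.det])
  simpa using this

/-- Update the removal weights after `removeProg`. -/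
def refreshProg : Prog :=
  .seq (block [.nconst 9 0])
    (.loop (.nlt 9 3)
      (.seq
        (.seq (block [.nload 8 0 9, .rconst 12 0, .nconst 10 0])
          (.loop (.nlt 10 1)
            (block [.rload 10 0 10 8, .rload 11 3 10 5, .rmul 10 10 11, .radd 12 12 10,
              .nadd 10 10 4])))
        (block [.rmul 12 12 12, .rmul 12 12 3, .rload 10 4 8 5, .radd 10 10 12, .rstore 4 8 5 10,
          .nadd 9 9 4])))

theorem Inv.term_refreshProg {σ : State} (h : Inv X lam s S σ) (hd : 0 < d) :
    Term refreshProg σ (S.card * (36 * d) + 5) fun τ => Inv X lam s S τ ∧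
      ∀ i ∈ S, τ.rarr 4 i 0 = σ.rarr 4 i 0 + σ.rreg 3 * (X.col i ⬝ᵥ vecOf d σ) ^ 2 := by
  let v : ℕ → ℝ := fun j =>
    σ.rarr 4 j 0 + σ.rreg 3 * (∑ b ∈ Finset.range d, σ.rarr 0 b j * σ.rarr 3 b 0) ^ 2
  let I : ℕ → State → Prop := fun k τ => SameData σ τ ∧ τ.nreg 9 = k ∧ τ.rreg 3 = σ.rreg 3 ∧
    (∀ i j, τ.rarr 3 i j = σ.rarr 3 i j) ∧
    ∀ l < S.card, τ.rarr 4 (σ.narr 0 l) 0 =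
      if l < k then v (σ.narr 0 l) else σ.rarr 4 (σ.narr 0 l) 0
  refine (Term.block_seq (by simp [Instr.IsDet]) (Term.loop (N := S.card) (k := 12 * d + 23) I
    ?_ ?_ ?_)).mono ?_ ?_
  · rintro k τ hk ⟨hs, h9, -⟩
    simp [Test.Holds, h9, (h.sameData hs).card]
  · intro k τ hk hτ
    have hdot : Term (.seq (block [.nload 8 0 9, .rconst 12 0, .nconst 10 0])
        (.loop (.nlt 10 1) (block [.rload 10 0 10 8, .rload 11 3 10 5, .rmul 10 10 11,
          .radd 12 12 10, .nadd 10 10 4]))) τ (12 * d + 9) fun υ => I k υ ∧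
          υ.nreg 8 = σ.narr 0 k ∧
          υ.rreg 12 = ∑ b ∈ Finset.range d, σ.rarr 0 b (σ.narr 0 k) * σ.rarr 3 b 0 := by
      refine (Term.block_seq (by simp [Instr.IsDet]) (Term.loop (N := d) (k := 11)
        (fun b υ => I k υ ∧ υ.nreg 8 = σ.narr 0 k ∧ υ.nreg 10 = b ∧
          υ.rreg 12 = ∑ b ∈ Finset.range b, σ.rarr 0 b (σ.narr 0 k) * σ.rarr 3 b 0) ?_ ?_ ?_)).mono
          (by simp; omega) ?_
      · rintro b υ hb ⟨⟨hs, -⟩, -, h10, -⟩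
        simp [Test.Holds, h10, (h.sameData hs).consts.dim]
      · rintro b υ hb ⟨⟨hs, h9, h3, hr, h4⟩, h8, h10, h12⟩
        have hc := (h.sameData hs).consts
        refine (Term.block (by simp [Instr.IsDet]) ⟨⟨hs.execs (by simp [Instr.Safe]), ?_, ?_, ?_,
          ?_⟩, ?_, ?_, ?_⟩).mono (k := 11) le_rfl fun _ => id
        · simp [execs, Instr.det, h9]
        · simp [execs, Instr.det, h3]
        · exact hr
        · exact h4
        · simp [execs, Instr.det, h8]
        · simp [execs, Instr.det, h10, hc.one]
        · simp [execs, Instr.det, h10, h8, h12, hr, hs.rarr 0, hc.zero, Finset.sum_range_succ]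
      · obtain ⟨hs, h9, h3, hr, h4⟩ := hτ
        refine ⟨⟨hs.execs (by simp [Instr.Safe]), ?_, ?_, hr, h4⟩, ?_, ?_, ?_⟩
        · simp [execs, Instr.det, h9]
        · simp [execs, Instr.det, h3]
        · simp [execs, Instr.det, h9, hs.narr]
        · simp [execs, Instr.det]
        · simp [execs, Instr.det]
      · rintro υ ⟨h1, h2, -, h3⟩
        exact ⟨h1, h2, h3⟩
    refine (Term.seq hdot fun υ hυ => Term.block (by simp [Instr.IsDet]) ?_).mono le_rfl fun _ => id
    obtain ⟨⟨hs, h9, h3, hr, h4⟩, h8, h12⟩ := hυ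
    have hc := (h.sameData hs).consts
    refine ⟨hs.execs (by simp [Instr.Safe]), ?_, ?_, ?_, ?_⟩
    · simp [execs, Instr.det, h9, hc.one]
    · simp [execs, Instr.det, h3]
    · intro i j
      simp [execs, Instr.det, hr]
    · intro l hl
      by_cases hlk : l = k
      · have := h4 l hl
        rw [if_neg (by omega), hlk] at this
        simp [execs, Instr.det, h8, hlk, hc.zero, h3, h12, this, v]
        ring
      · have hne : σ.narr 0 l ≠ σ.narr 0 k := fun e =>
          hlk (h.lists.injOn (by simpa using hl) (by simpa using hk) e)
        have hiff : l < k + 1 ↔ l < k := by omega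
        simp only [hiff]
        simpa [execs, Instr.det, h8, hne] using h4 l hl
  · exact ⟨(SameData.refl σ).execs (by simp [Instr.Safe]), by simp [execs, Instr.det],
      by simp [execs, Instr.det], fun _ _ => rfl, by simp [execs, Instr.det]⟩
  · simp only [List.length_cons, List.length_nil]
    nlinarith
  · rintro τ ⟨hs, -, -, -, h4⟩
    refine ⟨h.sameData hs, fun i hi => ?_⟩
    obtain ⟨p, hp, e⟩ := h.lists.exists_index hi
    have := h4 p hp
    rw [if_pos hp, e] at this
    rw [this, ← h.cols i]
    simp [v, dotProduct, colOf, vecOf, Finset.sum_range]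

/-- Remove elements by exact sampling until `s` elements are left. -/
def exactProg : Prog :=
  .loop (.nlt 2 3)
    (.seq drawProg (.seq (block [.nload 8 0 7]) (.seq quadProg (.seq removeProg refreshProg))))

/-- No deficit occurs here, since every round removes an element. A round costs `O(d²)` as `|S| ≤
2d`: drawing takes `O(|S|)`, the inverse `O(d²)`, and refreshing the weights `O(|S| d)`. -/
theorem le_val_exactProg (hd : 0 < d) (hl : 0 ≤ lam) (had : 0 < lam ∨ d ≤ s)
    {R : Finset (Fin n) → Prop} (hQ : ∀ σ, Q σ ↔ R (output n s σ)) (k : ℕ) :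
    ∀ S σ, (regGram X lam S).PosDef → Inv X lam s S σ → Scores X lam S σ → S.card = s + k →
      S.card ≤ max s (2 * d) →
      condProb X lam R k S ≤ val Q (1 + k * (320 * d ^ 2)) [exactProg] σ := by
  have hd2 : 1 ≤ d ^ 2 := Nat.one_le_pow _ _ hd
  have hdd : d ≤ d ^ 2 := by nlinarith
  induction k with
  | zero =>
    intro S σ hS h hsc hcard hle
    rw [exactProg, zero_mul, add_zero, ← zero_add 1,
      val_loop_false (by simp [Test.Holds, h.size, h.card, hcard])]
    by_cases hR : R S
    · rw [val_nil ((hQ σ).2 (by rwa [h.output hcard]))]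
      simp [condProb, hR]
    · simpa [condProb, hR] using val_nonneg _ _ _
  | succ k ih =>
    intro S σ hS h hsc hcard hle
    -- More than `s` elements are left, so the maximum in the threshold must be `2d`.
    have hle2 : S.card ≤ 2 * d := by omega
    have hne : S.Nonempty := Finset.card_pos.1 (by omega)
    have hpos : 0 < ∑ i ∈ S, lev X lam S i :=
      sum_lev_pos hl hS (had.imp_right fun h => by omega) hne
    let G : ℕ → ℝ := fun j => if hj : j < n then lev X lam S ⟨j, hj⟩ else 0
    -- Elements of weight zero get the value `0`, a lower bound that is free; their true
    -- continuation would need the inverse of a possibly singular matrix.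
    let F : ℕ → ℝ := fun j => if hj : j < n then
      (if lev X lam S ⟨j, hj⟩ = 0 then 0 else condProb X lam R k (S.erase ⟨j, hj⟩)) else 0
    have hG : ∀ i : Fin n, G i = lev X lam S i := fun i => by simp [G]
    have hF : ∀ i : Fin n, F i =
        if lev X lam S i = 0 then 0 else condProb X lam R k (S.erase i) := fun i => by simp [F]
    have hsum : ∑ l ∈ Finset.range S.card, G (σ.narr 0 l) = ∑ i ∈ S, lev X lam S i := by
      rw [h.lists.sum_eq]
      exact Finset.sum_congr rfl fun i _ => hG i
    have hval : condProb X lam R (k + 1) S =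
        (∑ l ∈ Finset.range S.card, G (σ.narr 0 l) * F (σ.narr 0 l)) /
          ∑ l ∈ Finset.range S.card, G (σ.narr 0 l) := by
      rw [hsum, h.lists.sum_eq (fun j => G j * F j), eq_div_iff hpos.ne', mul_comm,
        ← sum_lev_mul_condProb R k hS hpos]
      refine Finset.sum_congr rfl fun i _ => ?_
      rw [hG, hF]
      split_ifs with h0
      · simp [h0]
      · rfl
    rw [hval]
    refine le_trans ?_ (val_mono (show 1 + k * (320 * d ^ 2) + (140 * d ^ 2 +
      (S.card * (36 * d) + 5) + 6) + 1 + S.card * 30 + 9 + 1 + 1 ≤ _ by nlinarith) _ _)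
    rw [exactProg, val_loop_true (by simp only [Test.Holds, h.size, h.card]; omega), val_seq]
    refine le_val_drawProg h.consts.one h.consts.zero h.card
      (F := fun l => F (σ.narr 0 l)) (fun l hl => ?_) (fun l hl' => ?_) (by rwa [hsum]) ?_
    · obtain ⟨i, hi, e⟩ := h.lists.exists_mem hl
      rw [e, hG, hsc i hi]
    · obtain ⟨i, hi, e⟩ := h.lists.exists_mem hl'
      rw [e, hG]
      exact lev_nonneg hl hS hi
    · intro p hp τ hs h4 h7
      obtain ⟨i, hi, e⟩ := h.lists.exists_mem hp
      simp only [e, hF]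
      split_ifs with h0
      · exact val_nonneg _ _ _
      set τ₁ := execs [.nload 8 0 7] τ with hτ₁
      have hs₁ : SameData σ τ₁ := hs.execs (by simp [Instr.Safe])
      have hI₁ := h.sameData hs₁
      have h8 : τ₁.nreg 8 = i := by simp [hτ₁, execs, Instr.det, h7, hs.narr, e]
      have h7₁ : τ₁.nreg 7 = p := by simp [hτ₁, execs, Instr.det, h7]
      have hcard' : (S.erase i).card = s + k := by
        rw [Finset.card_erase_of_mem hi]; omega
      refine le_val_of_term (P := fun υ => Inv X lam s (S.erase i) υ ∧ Scores X lam (S.erase i) υ)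
        (k := 140 * d ^ 2 + (S.card * (36 * d) + 5) + 6) ?_ (fun υ hυ => ih _ υ
          (posDef_erase hl hS hi (lt_of_le_of_ne (lev_nonneg hl hS hi) (Ne.symm h0))) hυ.1 hυ.2
          hcard' (by omega)) (by omega)
      refine (Term.block_seq (by simp [Instr.IsDet]) (Term.seq (hI₁.term_quadProg hd h8)
        (l := 80 * d ^ 2 + (S.card * (36 * d) + 5) + 1) fun υ hυ => ?_)).mono (by simp; omega)
        fun _ => id
      obtain ⟨f, hs₂, hI₂, hv, h2⟩ := hυ
      have h4₂ : ∀ i j, υ.rarr 4 i j = σ.rarr 4 i j := fun i j =>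
        (f.rarr 4 (by norm_num) (by norm_num) i j).trans (h4 i j)
      refine Term.seq (hI₂.term_removeProg hd hS hi hp
        ((f.nreg 7 (by norm_num)).trans h7₁) (by rw [hs₂.narr, hs₁.narr, e]) hv h2 h0) ?_
      rintro ω ⟨hIω, hvω, h3ω, h4ω⟩
      refine (hIω.term_refreshProg hd).mono ?_ ?_
      · have : (S.erase i).card ≤ S.card := Finset.card_le_card (Finset.erase_subset i S)
        gcongr
      · rintro ρ ⟨hIρ, h4ρ⟩
        refine ⟨hIρ, fun j hj => ?_⟩
        rw [h4ρ j hj, h4ω, h4₂, hsc j (Finset.mem_of_mem_erase hj), h3ω, hvω, hv,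
          lev_erase hS hi h0]

end RealRAM

namespace RealRAM

open Matrix VolumeSampling

variable {d n : ℕ} {X : Matrix (Fin d) (Fin n) ℝ} {lam : ℝ} {s : ℕ} {S : Finset (Fin n)}
  {Q : State → Prop}

/-! ### Computing the initial inverse -/

/-- The input has been extended by the unit vectors, stored as columns `n` to `n + d - 1`. -/
structure Loaded (X : Matrix (Fin d) (Fin n) ℝ) (lam : ℝ) (s : ℕ) (σ : State) : Prop where
  consts : Consts d σ
  num : σ.nreg 0 = n
  size : σ.nreg 2 = s
  reg : σ.rreg 0 = lam
  rone : σ.rreg 1 = 1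
  cols : ∀ i : Fin n, colOf d σ i = X.col i
  unit : ∀ k : Fin d, colOf d σ (n + k) = Pi.single k 1

theorem Loaded.of_eq {σ τ : State} (h : Loaded X lam s σ)
    (hn : ∀ a < 7, a ≠ 3 → τ.nreg a = σ.nreg a) (hr : ∀ a < 2, τ.rreg a = σ.rreg a)
    (hX : ∀ i j, τ.rarr 0 i j = σ.rarr 0 i j) : Loaded X lam s τ where
  consts := ⟨(hn 1 (by norm_num) (by norm_num)).trans h.consts.dim,
    (hn 4 (by norm_num) (by norm_num)).trans h.consts.one,
    (hn 5 (by norm_num) (by norm_num)).trans h.consts.zero⟩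
  num := (hn 0 (by norm_num) (by norm_num)).trans h.num
  size := (hn 2 (by norm_num) (by norm_num)).trans h.size
  reg := (hr 0 (by norm_num)).trans h.reg
  rone := (hr 1 (by norm_num)).trans h.rone
  cols i := (funext fun a => hX a i : colOf d τ i = colOf d σ i).trans (h.cols i)
  unit k := (funext fun a => hX a (n + k) : colOf d τ (n + k) = colOf d σ (n + k)).trans (h.unit k)

theorem Loaded.sameData {σ τ : State} (h : Loaded X lam s σ) (h' : SameData σ τ) :
    Loaded X lam s τ :=
  h.of_eq (fun a ha _ => h'.nreg a ha) h'.rreg (h'.rarr 0 (by norm_num))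

/-- Replace the inverse `A⁻¹` by the inverse of `A + c v vᵀ`, where `c` is held by real register
`5` and `v` is the current column. -/
def rankOneProg : Prog :=
  .seq quadProg (.seq (block [.rmul 11 5 2, .radd 11 1 11, .rdiv 3 5 11]) updateProg)

/-- Positive definiteness on both sides of the update makes the division legitimate, also for
negative `c`, which the ridge phase uses when `lam < 1`. -/
theorem Loaded.term_rankOneProg {σ : State} (h : Loaded X lam s σ) (hd : 0 < d)
    {A : Matrix (Fin d) (Fin d) ℝ} (hA : A.PosDef) (hmat : matOf d σ = A⁻¹) {v : Fin d → ℝ} {c : ℝ}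
    (hv : colOf d σ (σ.nreg 8) = v) (hc : σ.rreg 5 = c) (hB : (A + c • vecMulVec v v).PosDef) :
    Term rankOneProg σ (130 * d ^ 2) fun τ => Loaded X lam s τ ∧ τ.nreg 9 = σ.nreg 9 ∧
      τ.rreg 5 = c ∧ τ.narr = σ.narr ∧ matOf d τ = (A + c • vecMulVec v v)⁻¹ := by
  have hd2 : 1 ≤ d ^ 2 := Nat.one_le_pow _ _ hd
  refine (Term.seq (term_quadProg h.consts hd) (l := 60 * d ^ 2 + 8) ?_).mono (by omega) fun _ => id
  rintro τ ⟨f, h1, hw, hq⟩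
  have hτ := h.sameData (f.sameData h1)
  set τ₁ := execs [.rmul 11 5 2, .radd 11 1 11, .rdiv 3 5 11] τ with hτ₁
  have hs₁ : SameData τ τ₁ := (SameData.refl τ).execs (by simp [Instr.Safe])
  have hl₁ := hτ.sameData hs₁
  have h5 : τ.rreg 5 = c := (f.rreg 5 (by norm_num) (by norm_num)).trans hc
  have h5₁ : τ₁.rreg 5 = c := by simp [hτ₁, execs, Instr.det, h5]
  have h3 : τ₁.rreg 3 = c / (1 + c * (v ⬝ᵥ (A⁻¹ *ᵥ v))) := by
    simp [hτ₁, execs, Instr.det, h5, hτ.rone, hq, hv, hmat]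
  have h9 : τ₁.nreg 9 = σ.nreg 9 := f.nreg 9 (by norm_num)
  have hm : matOf d τ₁ = A⁻¹ := by
    rw [← hmat]
    ext a b
    exact h1 a b
  have hw₁ : vecOf d τ₁ = A⁻¹ *ᵥ v := by
    rw [← hmat, ← hv, ← hw]
    rfl
  refine (Term.block_seq (by simp [Instr.IsDet]) (term_updateProg hl₁.consts hd)).mono
    (by simp; omega) ?_
  rintro υ ⟨f', -, -, hu⟩
  rw [← hτ₁] at f' hu
  refine ⟨hl₁.of_eq (fun a ha _ => f'.nreg a (by omega))
    (fun a ha => f'.rreg a (by omega) (by omega)) (f'.rarr 0 (by norm_num) (by norm_num)),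
    (f'.nreg 9 (by norm_num)).trans h9, (f'.rreg 5 (by norm_num) (by norm_num)).trans h5₁,
    f'.narr.trans (hs₁.narr.trans f.narr), ?_⟩
  rw [hu, hm, h3, hw₁, inv_add_smul_vecMulVec hA _ _ (one_add_mul_pos hA v c hB).ne']

/-- Store the unit vectors as additional columns, and the identity matrix in real array `1`. -/
def initProg : Prog :=
  .seq (block [.nconst 4 1, .rconst 1 1, .nconst 9 0])
    (.loop (.nlt 9 1)
      (block [.nadd 8 0 9, .rstore 0 9 8 1, .rstore 1 9 9 1, .nadd 9 9 4]))

/-- The zeros of the input convention are used twice: as the off-diagonal entries of the identity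
and the unit vectors, and as the constant in integer register `5`, which is never written. -/
theorem term_initProg (X : Matrix (Fin d) (Fin n) ℝ) (lam : ℝ) (s : ℕ) :
    Term initProg (input X lam s) (10 * d + 9) fun τ => Loaded X lam s τ ∧ matOf d τ = 1 := by
  refine (Term.block_seq (by simp [Instr.IsDet]) (Term.loop (N := d) (k := 9)
    (fun k τ => Consts d τ ∧ τ.nreg 0 = n ∧ τ.nreg 2 = s ∧ τ.rreg 0 = lam ∧ τ.rreg 1 = 1 ∧
      τ.nreg 9 = k ∧
      (∀ i j, τ.rarr 0 i j = if i < k ∧ j = n + i then 1 else (input X lam s).rarr 0 i j) ∧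
      ∀ i j, τ.rarr 1 i j = if i < k ∧ j = i then 1 else 0) ?_ ?_ ?_)).mono
      (by simp; omega) ?_
  · rintro k τ hk ⟨hc, -, -, -, -, h9, -⟩
    simp [Test.Holds, h9, hc.dim]
  · rintro k τ hk ⟨hc, h0, h2, hr0, hr1, h9, hX, hZ⟩
    refine (Term.block (by simp [Instr.IsDet]) ⟨⟨?_, ?_, ?_⟩, ?_, ?_, ?_, ?_, ?_, ?_, ?_⟩).mono
      (k := 9) le_rfl fun _ => id
    · simp [execs, Instr.det, hc.dim]
    · simp [execs, Instr.det, hc.one]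
    · simp [execs, Instr.det, hc.zero]
    · simp [execs, Instr.det, h0]
    · simp [execs, Instr.det, h2]
    · simp [execs, Instr.det, hr0]
    · simp [execs, Instr.det, hr1]
    · simp [execs, Instr.det, h9, hc.one]
    · intro i j
      by_cases hij : i = k ∧ j = n + k
      · simp [execs, Instr.det, h9, h0, hij, hr1]
      · have : (i < k + 1 ∧ j = n + i) ↔ (i < k ∧ j = n + i) := by omega
        simp only [this]
        simp [execs, Instr.det, h9, h0, hij, hX]
    · intro i j
      by_cases hij : i = k ∧ j = k
      · simp [execs, Instr.det, h9, hij, hr1]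
      · have : (i < k + 1 ∧ j = i) ↔ (i < k ∧ j = i) := by omega
        simp only [this]
        simp [execs, Instr.det, h9, hij, hZ]
  · refine ⟨⟨?_, ?_, ?_⟩, ?_, ?_, ?_, ?_, ?_, ?_, ?_⟩ <;> simp [execs, Instr.det, input]
  · rintro τ ⟨hc, h0, h2, hr0, hr1, -, hX, hZ⟩
    refine ⟨⟨hc, h0, h2, hr0, hr1, fun i => ?_, fun k => ?_⟩, ?_⟩
    · ext a
      have hi : ¬ ((i : ℕ) = n + a) := by omega
      simp [colOf, hX, hi, input]
    · ext a
      rcases eq_or_ne a k with rfl | hak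
      · simp [colOf, hX]
      · have h1 : ¬ ((k : ℕ) = a) := fun e => hak (Fin.ext e.symm)
        simp [colOf, hX, h1, input, hak]
    · ext a b
      rcases eq_or_ne a b with rfl | hab
      · simp [matOf, hZ]
      · have h1 : ¬ ((b : ℕ) = a) := fun e => hab (Fin.ext e.symm)
        simp [matOf, hZ, h1, hab]

/-- Add the rank-one matrices given by the columns of the input. -/
def gramProg : Prog :=
  .seq (block [.rcopy 5 1, .nconst 9 0])
    (.loop (.nlt 9 0)
      (.seq (block [.nstore 0 9 9, .ncopy 8 9]) (.seq rankOneProg (block [.nadd 9 9 4]))))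

theorem regGram_filter_succ (X : Matrix (Fin d) (Fin n) ℝ) (c : ℝ) {k : ℕ} (hk : k < n) :
    regGram X c ({i | (i : ℕ) < k + 1} : Finset (Fin n)) =
      regGram X c ({i | (i : ℕ) < k} : Finset (Fin n)) +
        (1 : ℝ) • vecMulVec (X.col ⟨k, hk⟩) (X.col ⟨k, hk⟩) := by
  have : ({i | (i : ℕ) < k + 1} : Finset (Fin n)) =
      insert ⟨k, hk⟩ ({i | (i : ℕ) < k} : Finset (Fin n)) := by
    ext i
    simp only [Finset.mem_filter_univ, Finset.mem_insert, Fin.ext_iff]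
    omega
  rw [this, regGram_eq_sum, regGram_eq_sum, Finset.sum_insert (by simp), one_smul]
  abel

/-- The ridge is taken to be `1` at first, so that every partial Gram matrix is positive definite
even if `lam = 0`. -/
theorem Loaded.term_gramProg {σ : State} (h : Loaded X lam s σ) (hd : 0 < d)
    (hmat : matOf d σ = 1) :
    Term gramProg σ (n * (150 * d ^ 2) + 7) fun τ => Loaded X lam s τ ∧
      (∀ l < n, τ.narr 0 l = l) ∧ matOf d τ = (X * Xᵀ + diagonal fun _ => (1 : ℝ))⁻¹ := by
  have hd2 : 1 ≤ d ^ 2 := Nat.one_le_pow _ _ hd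
  refine (Term.block_seq (by simp [Instr.IsDet]) (Term.loop (N := n) (k := 130 * d ^ 2 + 10)
    (fun k τ => Loaded X lam s τ ∧ τ.nreg 9 = k ∧ τ.rreg 5 = 1 ∧ (∀ l < k, τ.narr 0 l = l) ∧
      matOf d τ = (regGram X 1 ({i | (i : ℕ) < k} : Finset (Fin n)))⁻¹) ?_ ?_ ?_)).mono
      (by simp; nlinarith) ?_
  · rintro k τ hk ⟨hl, h9, -⟩
    simp [Test.Holds, h9, hl.num]
  · rintro k τ hk ⟨hl, h9, h5, ha, hm⟩
    set τ₁ := execs [.nstore 0 9 9, .ncopy 8 9] τ with hτ₁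
    have hl₁ : Loaded X lam s τ₁ := hl.of_eq (fun a ha _ => by
      simp [hτ₁, execs, Instr.det, show a ≠ 8 by omega]) (fun _ _ => rfl) (fun _ _ => rfl)
    have h8 : τ₁.nreg 8 = k := by simp [hτ₁, execs, Instr.det, h9]
    have h9₁ : τ₁.nreg 9 = k := by simp [hτ₁, execs, Instr.det, h9]
    have ha₁ : ∀ l < k + 1, τ₁.narr 0 l = l := by
      intro l hlk
      by_cases e : l = k
      · simp [hτ₁, execs, Instr.det, h9, e]
      · simp [hτ₁, execs, Instr.det, h9, e, ha l (by omega)]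
    have hB := posDef_of_pos (X := X) one_pos ({i | (i : ℕ) < k + 1} : Finset (Fin n))
    rw [regGram_filter_succ X 1 hk] at hB
    refine (Term.block_seq (by simp [Instr.IsDet]) (Term.seq (hl₁.term_rankOneProg hd
      (posDef_of_pos one_pos _) (show matOf d τ₁ = _ from hm)
      (by rw [h8]; exact hl₁.cols ⟨k, hk⟩) h5 hB)
      fun υ hυ => Term.block (by simp [Instr.IsDet]) ?_)).mono (by simp; omega) fun _ => id
    obtain ⟨hlυ, h9υ, h5υ, haυ, hmυ⟩ := hυ
    refine ⟨hlυ.sameData ((SameData.refl υ).execs (by simp [Instr.Safe])), ?_, ?_, ?_, ?_⟩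
    · simp [execs, Instr.det, h9υ, h9₁, hlυ.consts.one]
    · simp [execs, Instr.det, h5υ]
    · intro l hlk
      simp [execs, Instr.det, haυ, ha₁ l hlk]
    · rw [regGram_filter_succ X 1 hk, ← hmυ]
      rfl
  · refine ⟨h.sameData ((SameData.refl σ).execs (by simp [Instr.Safe])), ?_, ?_, by simp, ?_⟩
    · simp [execs, Instr.det]
    · simp [execs, Instr.det, h.rone]
    · have e : regGram X 1 ({i | (i : ℕ) < 0} : Finset (Fin n)) = 1 := by simp [regGram_eq_sum]
      rw [e, inv_one, ← hmat]
      rfl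
  · rintro τ ⟨hl, -, -, ha, hm⟩
    refine ⟨hl, ha, ?_⟩
    rw [hm, ← regGram_univ]
    simp

/-- Replace the identity matrix by its multiple with the regularization parameter, one diagonal
entry after the other. -/
def ridgeProg : Prog :=
  .seq (block [.rsub 5 0 1, .nconst 9 0])
    (.loop (.nlt 9 1)
      (.seq (block [.nadd 8 0 9]) (.seq rankOneProg (block [.nadd 9 9 4]))))

theorem diagonal_ite_succ (lam : ℝ) {k : ℕ} (hk : k < d) :
    (diagonal fun i : Fin d => if (i : ℕ) < k + 1 then lam else 1) =
      (diagonal fun i : Fin d => if (i : ℕ) < k then lam else 1) +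
        (lam - 1) • vecMulVec (Pi.single ⟨k, hk⟩ 1) (Pi.single ⟨k, hk⟩ 1) := by
  ext a b
  rcases eq_or_ne a b with rfl | hab
  · rcases eq_or_ne a ⟨k, hk⟩ with rfl | hak
    · simp [vecMulVec_apply]
    · have h1 : (a : ℕ) ≠ k := fun e => hak (Fin.ext e)
      have h2 : (a : ℕ) < k + 1 ↔ (a : ℕ) < k := by omega
      simp [vecMulVec_apply, hak, h2, -Order.lt_add_one_iff]
  · rcases eq_or_ne a ⟨k, hk⟩ with rfl | hak
    · simp [vecMulVec_apply, hab, hab.symm]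
    · simp [vecMulVec_apply, hab, hak]

/-- Lowering or raising the ridge after all columns have been added keeps every intermediate matrix
definite: its diagonal part has entries `lam` and `1`, and if `lam` is not positive then `X Xᵀ` is
itself definite. -/
theorem Loaded.term_ridgeProg {σ : State} (h : Loaded X lam s σ) (hd : 0 < d) (hl0 : 0 ≤ lam)
    (had : 0 < lam ∨ X.rank = d) (ha : ∀ l < n, σ.narr 0 l = l)
    (hmat : matOf d σ = (X * Xᵀ + diagonal fun _ => (1 : ℝ))⁻¹) :
    Term ridgeProg σ (d * (150 * d ^ 2) + 7) fun τ => Loaded X lam s τ ∧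
      (∀ l < n, τ.narr 0 l = l) ∧ matOf d τ = (regGram X lam Finset.univ)⁻¹ := by
  have hd2 : 1 ≤ d ^ 2 := Nat.one_le_pow _ _ hd
  have hpd : ∀ k : ℕ,
      (X * Xᵀ + diagonal fun i : Fin d => if (i : ℕ) < k then lam else 1).PosDef := by
    refine fun k => posDef_gram_add_diagonal X _ (fun i => ?_) (had.imp_left fun hl i => ?_) <;>
      split_ifs <;> first | assumption | norm_num
  refine (Term.block_seq (by simp [Instr.IsDet]) (Term.loop (N := d) (k := 130 * d ^ 2 + 8)
    (fun k τ => Loaded X lam s τ ∧ τ.nreg 9 = k ∧ τ.rreg 5 = lam - 1 ∧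
      (∀ l < n, τ.narr 0 l = l) ∧ matOf d τ =
        (X * Xᵀ + diagonal fun i : Fin d => if (i : ℕ) < k then lam else 1)⁻¹) ?_ ?_ ?_)).mono
      (by simp; nlinarith) ?_
  · rintro k τ hk ⟨hl, h9, -⟩
    simp [Test.Holds, h9, hl.consts.dim]
  · rintro k τ hk ⟨hl, h9, h5, ha, hm⟩
    set τ₁ := execs [.nadd 8 0 9] τ with hτ₁
    have hl₁ : Loaded X lam s τ₁ := hl.sameData ((SameData.refl τ).execs (by simp [Instr.Safe]))
    have h8 : τ₁.nreg 8 = n + k := by simp [hτ₁, execs, Instr.det, h9, hl.num]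
    have h9₁ : τ₁.nreg 9 = k := by simp [hτ₁, execs, Instr.det, h9]
    have ha₁ : ∀ l < n, τ₁.narr 0 l = l := ha
    have hB := hpd (k + 1)
    rw [diagonal_ite_succ lam hk, ← add_assoc] at hB
    refine (Term.block_seq (by simp [Instr.IsDet]) (Term.seq (hl₁.term_rankOneProg hd
      (hpd k) (show matOf d τ₁ = _ from hm)
      (by rw [h8]; exact hl₁.unit ⟨k, hk⟩) h5 hB)
      fun υ hυ => Term.block (by simp [Instr.IsDet]) ?_)).mono (by simp; omega) fun _ => id
    obtain ⟨hlυ, h9υ, h5υ, haυ, hmυ⟩ := hυ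
    refine ⟨hlυ.sameData ((SameData.refl υ).execs (by simp [Instr.Safe])), ?_, ?_, ?_, ?_⟩
    · simp [execs, Instr.det, h9υ, h9₁, hlυ.consts.one]
    · simp [execs, Instr.det, h5υ]
    · intro l hlk
      simp [execs, Instr.det, haυ, ha₁ l hlk]
    · rw [diagonal_ite_succ lam hk, ← add_assoc, ← hmυ]
      rfl
  · refine ⟨h.sameData ((SameData.refl σ).execs (by simp [Instr.Safe])), ?_, ?_, ha, ?_⟩
    · simp [execs, Instr.det]
    · simp [execs, Instr.det, h.rone, h.reg]
    · have e : matOf d (execs [.rsub 5 0 1, .nconst 9 0] σ) = matOf d σ := rfl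
      rw [e, hmat]
      simp
  · rintro τ ⟨hl, -, -, ha, hm⟩
    refine ⟨hl, ha, ?_⟩
    rw [hm, regGram_univ]
    simp

/-- Initialize the sampler with the set of all columns. -/
def setupProg : Prog :=
  .seq initProg (.seq gramProg (.seq ridgeProg
    (.seq (block [.ncopy 3 0, .nadd 6 1 1]) (.cond (.nlt 6 2) (block [.ncopy 6 2]) .skip))))

theorem term_setupProg (hd : 0 < d) (hl0 : 0 ≤ lam) (had : 0 < lam ∨ X.rank = d) :
    Term setupProg (input X lam s) (200 * ((n + d) * d ^ 2)) fun τ =>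
      Inv X lam s Finset.univ τ := by
  have hd2 : 1 ≤ d ^ 2 := Nat.one_le_pow _ _ hd
  refine (Term.seq (term_initProg X lam s) fun τ₁ h₁ =>
    Term.seq (h₁.1.term_gramProg hd h₁.2) fun τ₂ h₂ =>
    Term.seq (h₂.1.term_ridgeProg hd hl0 had h₂.2.1 h₂.2.2) (l := 10) ?_).mono ?_ fun _ => id
  · rintro τ ⟨h, ha, hm⟩
    set τ₁ := execs [.ncopy 3 0, .nadd 6 1 1] τ with hτ₁
    have h6 : τ₁.nreg 6 = d + d := by simp [hτ₁, execs, Instr.det, h.consts.dim]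
    have h2 : τ₁.nreg 2 = s := by simp [hτ₁, execs, Instr.det, h.size]
    have key : ∀ υ : State, (∀ a < 6, υ.nreg a = τ₁.nreg a) → υ.rreg = τ₁.rreg →
        υ.narr = τ₁.narr → υ.rarr = τ₁.rarr → υ.nreg 6 = max s (2 * d) →
        Inv X lam s Finset.univ υ := by
      intro υ hn hr ha' hX hthr
      refine ⟨⟨?_, ?_, ?_⟩, ?_, ?_, hthr, ?_, ?_, fun i => ?_, ?_⟩
      · simp [hn 1, hτ₁, execs, Instr.det, h.consts.dim]
      · simp [hn 4, hτ₁, execs, Instr.det, h.consts.one]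
      · simp [hn 5, hτ₁, execs, Instr.det, h.consts.zero]
      · simp [hn 2, h2]
      · simp [hn 3, hτ₁, execs, Instr.det, h.num]
      · simp [hr, hτ₁, execs, Instr.det, h.rone]
      · rw [Lists, ha']
        ext x
        simp only [Finset.card_univ, Fintype.card_fin, Finset.mem_image, Finset.mem_range,
          Finset.mem_map, Finset.mem_univ, true_and, Fin.valEmbedding_apply]
        constructor
        · rintro ⟨l, hl, rfl⟩
          exact ⟨⟨l, hl⟩, (ha l hl).symm⟩
        · rintro ⟨j, rfl⟩
          exact ⟨j, j.2, ha j j.2⟩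
      · rw [← h.cols i]
        exact funext fun a => by rw [colOf, colOf, hX]; rfl
      · rw [← hm]
        ext a b
        rw [matOf, of_apply, hX]
        rfl
    refine (Term.block_seq (k := 4) (by simp [Instr.IsDet]) ?_).mono (by simp) fun _ => id
    rw [← hτ₁]
    by_cases hlt : 2 * d < s
    · refine Term.cond_true (by simp only [Test.Holds, h6, h2]; omega)
        (Term.block (by simp [Instr.IsDet]) (key _ ?_ rfl rfl rfl ?_))
      · intro a ha
        simp [execs, Instr.det, show a ≠ 6 by omega]
      · simp [execs, Instr.det, h2]
        omega
    · refine (Term.cond_false (by simp only [Test.Holds, h6, h2]; omega)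
        (Term.skip (key _ (fun _ _ => rfl) rfl rfl rfl ?_))).mono (by norm_num) fun _ => id
      rw [h6]
      omega
  · nlinarith

/-! ### The assembled program. -/

/-- The volume sampling program. -/
def sampleProg : Prog := .seq setupProg (.seq rejectProg (.seq scoreProg exactProg))

theorem le_val_sampleProg (hd : 0 < d) (hs : s ≤ n) (hl : 0 ≤ lam) (had : 0 < lam ∨ d ≤ s)
    (hrank : 0 < lam ∨ X.rank = d) {R : Finset (Fin n) → Prop}
    (hQ : ∀ σ, Q σ ↔ R (output n s σ)) (r : ℕ) :
    condProb X lam R (n - s) Finset.univ -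
        (if n ≤ max s (2 * d) then 0 else 2 ^ n * (3 / 4 : ℝ) ^ r) ≤
      val Q (1200 * ((n + d) * d ^ 2) + r * (200 * d ^ 2)) [sampleProg] (input X lam s) := by
  have hd2 : 1 ≤ d ^ 2 := Nat.one_le_pow _ _ hd
  have hS : (regGram X lam Finset.univ).PosDef := by
    rw [regGram_univ]
    exact posDef_gram_add_diagonal X _ (fun _ => hl) (hrank.imp_left fun h _ => h)
  refine le_trans ?_ (val_mono (show (1 + 2 * d * (320 * d ^ 2) + (n * (80 * d ^ 2) + 5) + 1) + 1 +
    r * (200 * d ^ 2) + 1 + 200 * ((n + d) * d ^ 2) + 1 ≤ _ by nlinarith) _ _)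
  rw [sampleProg, val_seq]
  refine le_val_of_term (term_setupProg hd hl hrank) (fun τ hτ => ?_) le_rfl
  rw [val_seq]
  have := le_val_rejectProg (Q := Q) (R := R) (K := [.seq scoreProg exactProg])
    (B := 1 + 2 * d * (320 * d ^ 2) + (n * (80 * d ^ 2) + 5) + 1) hd hl (s := s) (X := X) ?_ r
    Finset.univ τ hS hτ (by simpa using hs)
  · simpa using this
  · intro S σ hS h hsS hle
    have hSn : S.card ≤ n := by simpa using S.card_le_univ
    rw [val_seq]
    refine le_val_of_term (h.term_scoreProg hd) (t := 1 + (S.card - s) * (320 * d ^ 2))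
      (fun υ hυ => ?_) ?_
    · exact le_val_exactProg hd hl had hQ _ S υ hS hυ.1 hυ.2 (by omega) hle
    -- If the threshold is `s` nothing is left to remove; otherwise `S.card ≤ 2d`.
    · have : S.card - s ≤ 2 * d := by omega
      gcongr

end RealRAM

namespace RealRAM

open VolumeSampling

/-! ## The law of the output and the running time -/

/-- The events are disjoint: each halted memory has one output. -/
theorem sum_haltProb_le_one (p : Prog) (σ : State) (t n s : ℕ) :
    ∑ T : Finset (Fin n), haltProb p σ t (fun τ => output n s τ = T) ≤ 1 := by
  simp only [haltProb, PMF.toOuterMeasure_apply]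
  rw [← Summable.tsum_finsetSum fun _ _ => ENNReal.summable, ← (run t ([p], σ)).tsum_coe]
  refine ENNReal.tsum_le_tsum fun c => ?_
  rw [Finset.sum_eq_single (output n s c.2)]
  · exact Set.indicator_le_self _ _ _
  · intro T _ hT
    exact Set.indicator_of_notMem (fun h => hT h.2.symm) _
  · simp

/-- From `2 ≤ e` and `3/4 ≤ e^(-1/4)`, the left side is at most `e^(n - r/4)`. -/
theorem two_pow_mul_le {n r : ℕ} {δ : ℝ} (hδ : 0 < δ)
    (hr : 4 * n + 4 * Real.log (1 / δ) ≤ (r : ℝ)) : 2 ^ n * (3 / 4 : ℝ) ^ r ≤ δ := by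
  have h2 : (2 : ℝ) ≤ Real.exp 1 := by
    have := Real.add_one_le_exp (1 : ℝ)
    linarith
  have h3 : (3 / 4 : ℝ) ≤ Real.exp (-(1 / 4)) := by
    have := Real.add_one_le_exp (-(1 / 4) : ℝ)
    linarith
  calc 2 ^ n * (3 / 4 : ℝ) ^ r ≤ Real.exp 1 ^ n * Real.exp (-(1 / 4)) ^ r := by gcongr
    _ = Real.exp (n - r / 4) := by
      rw [← Real.exp_nat_mul, ← Real.exp_nat_mul, ← Real.exp_add]
      congr 1
      ring
    _ ≤ Real.exp (Real.log δ) := by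
      rw [one_div, Real.log_inv] at hr
      exact Real.exp_le_exp.2 (by linarith)
    _ = δ := Real.exp_log hδ

variable {d n s : ℕ} {X : Matrix (Fin d) (Fin n) ℝ} {lam : ℝ}

/-- Lower bounds suffice for equality: the limiting probabilities dominate `regVolProb` termwise,
have total at most one, and `regVolProb` has total one. -/
theorem iSup_haltProb_sampleProg (hd : 0 < d) (hs : s ≤ n) (hl : 0 ≤ lam) (had : 0 < lam ∨ d ≤ s)
    (hrank : 0 < lam ∨ X.rank = d) (T : Finset (Fin n)) :
    ⨆ t, haltProb sampleProg (input X lam s) t (fun σ => output n s σ = T) =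
      ENNReal.ofReal (regVolProb X lam s T) := by
  set a : Finset (Fin n) → ENNReal := fun T =>
    ⨆ t, haltProb sampleProg (input X lam s) t (fun σ => output n s σ = T) with ha
  have hsum : ∑ T, a T ≤ 1 := by
    rw [ha, ENNReal.finsetSum_iSup_of_monotone fun T => haltProb_mono _ _]
    exact iSup_le fun t => sum_haltProb_le_one _ _ _ _ _
  have hfin : ∀ T, a T ≠ ⊤ := fun T => ne_top_of_le_ne_top ENNReal.one_ne_top
    ((Finset.single_le_sum (fun _ _ => zero_le) (Finset.mem_univ T)).trans hsum)
  have hle : ∀ T, regVolProb X lam s T ≤ (a T).toReal := by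
    intro T
    refine le_of_forall_pos_le_add fun ε hε => ?_
    obtain ⟨r, hr⟩ := exists_nat_ge (4 * n + 4 * Real.log (1 / ε))
    have h := le_val_sampleProg (Q := fun σ => output n s σ = T) (R := fun S => S = T) hd hs hl had
      hrank (fun _ => Iff.rfl) r
    rw [condProb_eq_univ] at h
    have h1 : (if n ≤ max s (2 * d) then 0 else 2 ^ n * (3 / 4 : ℝ) ^ r) ≤ ε := by
      split_ifs
      · exact hε.le
      · exact two_pow_mul_le hε hr
    have h2 : val (fun σ => output n s σ = T) (1200 * ((n + d) * d ^ 2) + r * (200 * d ^ 2))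
        [sampleProg] (input X lam s) ≤ (a T).toReal := by
      rw [← ENNReal.ofReal_le_iff_le_toReal (hfin T), ← haltProb_eq]
      exact le_iSup (fun t => haltProb sampleProg (input X lam s) t
        (fun σ => output n s σ = T)) _
    rw [regVolProb]
    linarith
  have hS : (regGram X lam Finset.univ).PosDef := by
    rw [regGram_univ]
    exact posDef_gram_add_diagonal X _ (fun _ => hl) (hrank.imp_left fun h _ => h)
  have hone : ∑ T, regVolProb X lam s T = 1 := by
    rw [← condProb_true hl had (n - s) hS (by simp; omega), ← add_zero (n - s), ← condProb_univ]
    simp [condProb, regVolProb]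
  have hsum' : ∑ T, (a T).toReal ≤ 1 := by
    rw [← ENNReal.toReal_sum fun T _ => hfin T]
    exact ENNReal.toReal_le_of_le_ofReal zero_le_one (by simpa using hsum)
  have heq := (Finset.sum_eq_sum_iff_of_le fun T _ => hle T).1
    (le_antisymm (Finset.sum_le_sum fun T _ => hle T) (hsum'.trans hone.ge)) T (Finset.mem_univ T)
  rw [heq, ENNReal.ofReal_toReal (hfin T)]

theorem haltProb_sampleProg_ge (hd : 0 < d) (hs : s ≤ n) (hl : 0 ≤ lam) (had : 0 < lam ∨ d ≤ s)
    (hrank : 0 < lam ∨ X.rank = d) {δ : ℝ} (hδ : 0 < δ) :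
    ENNReal.ofReal (1 - δ) ≤ haltProb sampleProg (input X lam s)
      ⌊3000 * ((n + d + max 0 (Real.log (n / d)) * Real.log (1 / δ)) * d ^ 2)⌋₊ (fun _ => True) := by
  rcases le_or_gt 1 δ with h1 | h1
  · rw [ENNReal.ofReal_of_nonpos (by linarith)]
    exact zero_le
  have hS : (regGram X lam Finset.univ).PosDef := by
    rw [regGram_univ]
    exact posDef_gram_add_diagonal X _ (fun _ => hl) (hrank.imp_left fun h _ => h)
  have hlog : 0 < Real.log (1 / δ) := Real.log_pos (by rw [lt_div_iff₀ hδ]; linarith)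
  have hd0 : (0 : ℝ) < d := by exact_mod_cast hd
  have main := fun r => le_val_sampleProg (Q := fun _ => True) (R := fun _ => True) hd hs hl had
    hrank (X := X) (fun _ => Iff.rfl) r
  rw [condProb_true hl had (n - s) hS (by simp; omega)] at main
  rw [haltProb_eq]
  refine ENNReal.ofReal_le_ofReal ?_
  -- In the first case no rejection round is run and nothing random enters the time bound. This
  -- matters because `log⁺ (n/d)` may be zero there, leaving no room for a term in `log (1/δ)`.
  by_cases hn : n ≤ max s (2 * d)
  · have h := main 0
    rw [if_pos hn] at h
    refine le_trans (by linarith) (h.trans (val_mono (Nat.le_floor ?_) _ _))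
    have h0 : 0 ≤ max 0 (Real.log (n / d)) * Real.log (1 / δ) :=
      mul_nonneg (le_max_left _ _) hlog.le
    push_cast
    rw [zero_mul, add_zero]
    exact mul_le_mul (by norm_num) (mul_le_mul_of_nonneg_right (by linarith) (by positivity))
      (by positivity) (by norm_num)
  · have hr0 : 0 ≤ 4 * (n : ℝ) + 4 * Real.log (1 / δ) := by positivity
    set r := ⌈4 * (n : ℝ) + 4 * Real.log (1 / δ)⌉₊ with hr
    have h := main r
    rw [if_neg hn] at h
    have h2 := two_pow_mul_le hδ (Nat.le_ceil (4 * (n : ℝ) + 4 * Real.log (1 / δ)))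
    refine le_trans (by linarith) (h.trans (val_mono (Nat.le_floor ?_) _ _))
    have hr1 : (r : ℝ) ≤ 4 * n + 4 * Real.log (1 / δ) + 1 := (Nat.ceil_lt_add_one hr0).le
    have hnd : 2 * d ≤ n := by omega
    have hnd' : (2 : ℝ) ≤ n / d := by
      rw [le_div_iff₀ hd0]
      exact_mod_cast hnd
    have hn1 : (1 : ℝ) ≤ n := by
      have : 1 ≤ n := by omega
      exact_mod_cast this
    -- As `n/d ≥ 2`, the logarithm is at least `log 2 > 1/2`, so a bare `log (1/δ)` is absorbed by
    -- the product at the price of a factor two.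
    have hL : 1 / 2 ≤ max 0 (Real.log (n / d)) := by
      refine le_trans ?_ (le_max_right _ _)
      refine le_trans ?_ (Real.log_le_log (by norm_num) hnd')
      have := Real.log_two_gt_d9
      linarith
    have h3 : Real.log (1 / δ) ≤ 2 * (max 0 (Real.log (n / d)) * Real.log (1 / δ)) := by
      nlinarith
    push_cast
    calc 1200 * (((n : ℝ) + d) * d ^ 2) + r * (200 * d ^ 2)
        = (1200 * (n + d) + 200 * r) * (d : ℝ) ^ 2 := by ring
      _ ≤ (3000 * (n + d + max 0 (Real.log (n / d)) * Real.log (1 / δ))) * (d : ℝ) ^ 2 := by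
        gcongr
        linarith
      _ = _ := by ring

end RealRAM

theorem theorem4 :
    ∃ (p : RealRAM.Prog) (C : ℝ), 0 < C ∧
      ∀ (d n s : ℕ) (X : Matrix (Fin d) (Fin n) ℝ) (lam : ℝ), 0 < d → s ≤ n →
        (0 < lam ∨ (lam = 0 ∧ X.rank = d ∧ d ≤ s)) →
        (∀ T : Finset (Fin n),
          (⨆ t : ℕ, RealRAM.haltProb p (RealRAM.input X lam s) t
              (fun σ => RealRAM.output n s σ = T)) =
            ENNReal.ofReal (VolumeSampling.regVolProb X lam s T)) ∧
        ∀ δ : ℝ, 0 < δ →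
          ENNReal.ofReal (1 - δ) ≤
            RealRAM.haltProb p (RealRAM.input X lam s)
              ⌊C * ((n + d + max 0 (Real.log (n / d)) * Real.log (1 / δ)) * d ^ 2)⌋₊
              (fun _ => True) := by
  refine ⟨RealRAM.sampleProg, 3000, by norm_num, fun d n s X lam hd hs hadm => ?_⟩
  have hl : 0 ≤ lam := hadm.elim le_of_lt fun h => h.1.ge
  have had : 0 < lam ∨ d ≤ s := hadm.imp_right fun h => h.2.2
  have hrank : 0 < lam ∨ X.rank = d := hadm.imp_right fun h => h.2.1
  exact ⟨RealRAM.iSup_haltProb_sampleProg hd hs hl had hrank,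
    fun δ hδ => RealRAM.haltProb_sampleProg_ge hd hs hl had hrank hδ⟩
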